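/- Let $(X,d)$ be a complete metric space equipped with a Borel regular outer measure $\mu$ that is doubling, i.e. there is $c_d>0$ with $0<\mu(B(x,2r))\le c_d\,\mu(B(x,r))<\infty$ for all balls $B(x,r)=\{y: d(x,y)<r\}$, and suppose that $X$ supports a $(1,1)$-Poincaré inequality: there are $c_P>0$ and $\lambda\ge 1$ such that for every ball $B(x,r)$, every locally integrable function $u$ on $X$ and every upper gradient $g$ of $u$, $$\frac1{\mu(B(x,r))}\int_{B(x,r)}|u-u_{B(x,r)}|\,d\mu\le c_P\, r\,\frac1{\mu(B(x,\lambda r))}\int_{B(x,\lambda r)}g\,d\mu ,$$ where $u_{B(x,r)}$ is the mean value of $u$ over $B(x,r)$. Here a nonnegative Borel function $g$ is an upper gradient of $u$ in an open set $U$ if $|u(x)-u(y)|\le\int_\gamma g\,ds$ for every compact rectifiable curve $\gamma$ in $U$ with end points $x,y$. Let $N^{1,1}_{\rm loc}(U)$ be the class of functions $v$ on $U$ such that, for every open $U'$ with $\overline{U'}$ a compact subset of $U$, $v$ is integrable on $U'$ and has an upper gradient in $U'$ that is integrable on $U'$. For a locally integrable function $u$ and an open set $U\subset X$ put $$\|Du\|(U)=\inf\Big\{\liminf_{i\to\infty}\int_U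 g_i\,d\mu:\ v_i\in N^{1,1}_{\rm loc}(U),\ v_i\to u\text{ in }L^1_{\rm loc}(U),\ g_i\text{ an upper gradient of }v_i\text{ in }U\Big\},$$ and $\|Du\|(A)=\inf\{\|Du\|(U): U\supset A\text{ open}\}$ for an arbitrary $A\subset X$. Let $BV(X)$ be the set of $u\in L^1(X)$ with $\|Du\|(X)<\infty$, and for an open set $\Omega\subset X$ let $BV_0(\Omega)$ be the set of $g\in BV(X)$ with $g=0$ a.e. in $X\setminus\Omega$. Given $f\in BV(X)$, a function $u\in BV(X)$ is a solution to the Dirichlet problem for least gradients in $\Omega$ with boundary data $f$ if $u-f\in BV_0(\Omega)$ and $\|Du\|(\overline\Omega)\le\|D(u+g)\|(\overline\Omega)$ for every $g\in BV_0(\Omega)$. **Corollary 5.2 (two-sided maximum principle).** Let $M_1,M_2\in\mathbb R$, let $f\in BV(X)$ satisfy $M_1\le f\le M_2$ a.e. on $X$, and let $\Omega\subset X$ be a domain (a nonempty connected open set) with $\mu(X\setminus\Omega)>0$. Then every solution $u$ to the Dirichlet problem for least gradients in $\Omega$ with boundary data $f$ satisfies $M_1\le u\le M_2$ a.e. in $\Omega$.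 -/

import Mathlib

open MeasureTheory Set Filter Topology
open scoped ENNReal

namespace LeastGradient

noncomputable section

/-- A (compact, rectifiable) curve `γ : [a, b] → X`: a continuous map of finite length.
Only the values of `γ` on `[a, b]` matter. -/
structure IsCurve {X : Type*} [MetricSpace X] (γ : ℝ → X) (a b : ℝ) : Prop where
  le : a ≤ b
  continuousOn : ContinuousOn γ (Icc a b)
  rectifiable : eVariationOn γ (Icc a b) ≠ ⊤

/-- The line integral `∫_γ g ds` of a nonnegative function along a rectifiable curve `γ` on
`[a, b]`, i.e. `∫₀^ℓ g (γ̃ s) ds` for the arc-length parametrization `γ̃` of `γ` and its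
length `ℓ`. -/
def lineIntegral {X : Type*} [MetricSpace X] (g : X → ℝ≥0∞) (γ : ℝ → X) (a b : ℝ) : ℝ≥0∞ :=
  ∫⁻ s in Icc 0 (eVariationOn γ (Icc a b)).toReal, g (naturalParameterization γ (Icc a b) a s)

/-- `g` is an upper gradient of `u` in `Ω`: `g` is a nonnegative (possibly infinite) Borel function
and `|u x - u y| ≤ ∫_γ g ds` for every curve `γ` in `Ω` with end points `x`, `y`.
The functions `u` are real-valued, so no convention for infinite values of `u` is needed. -/
structure IsUpperGradientOn {X : Type*} [MetricSpace X] [MeasurableSpace X]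
    (g : X → ℝ≥0∞) (u : X → ℝ) (Ω : Set X) : Prop where
  measurable : Measurable g
  le_lineIntegral : ∀ (γ : ℝ → X) (a b : ℝ), IsCurve γ a b → (∀ t ∈ Icc a b, γ t ∈ Ω) →
    ENNReal.ofReal |u (γ a) - u (γ b)| ≤ lineIntegral g γ a b

/-- `Ω' ⋐ Ω`: the set `Ω'` is open and its closure is a compact subset of `Ω`. -/
def CompactlyInside {X : Type*} [MetricSpace X] (Ω' Ω : Set X) : Prop :=
  IsOpen Ω' ∧ IsCompact (closure Ω') ∧ closure Ω' ⊆ Ω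

/-- The Newtonian space `N^{1,1}(Ω)`: integrable functions with an integrable upper gradient. -/
def MemN11 {X : Type*} [MetricSpace X] [MeasurableSpace X] (μ : Measure X)
    (u : X → ℝ) (Ω : Set X) : Prop :=
  IntegrableOn u Ω μ ∧ ∃ g : X → ℝ≥0∞, IsUpperGradientOn g u Ω ∧ ∫⁻ x in Ω, g x ∂μ ≠ ⊤

/-- The local Newtonian space `N^{1,1}_loc(Ω)`. -/
def MemN11Loc {X : Type*} [MetricSpace X] [MeasurableSpace X] (μ : Measure X)
    (u : X → ℝ) (Ω : Set X) : Prop :=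
  ∀ Ω' : Set X, CompactlyInside Ω' Ω → MemN11 μ u Ω'

/-- Convergence `v i → u` in `L¹_loc(Ω)`. -/
def TendstoL1Loc {X : Type*} [MetricSpace X] [MeasurableSpace X] (μ : Measure X)
    (v : ℕ → X → ℝ) (u : X → ℝ) (Ω : Set X) : Prop :=
  ∀ Ω' : Set X, CompactlyInside Ω' Ω →
    Tendsto (fun i => ∫⁻ x in Ω', ‖v i x - u x‖ₑ ∂μ) atTop (𝓝 0)

/-- The total variation `‖Du‖(Ω)` of `u` in an open set `Ω`: the infimum of
`liminf_i ∫_Ω g_i dμ` over all sequences `v_i ∈ N^{1,1}_loc(Ω)` converging to `u` in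
`L¹_loc(Ω)` and all upper gradients `g_i` of `v_i` in `Ω`. -/
def openVariation {X : Type*} [MetricSpace X] [MeasurableSpace X] (μ : Measure X)
    (u : X → ℝ) (Ω : Set X) : ℝ≥0∞ :=
  ⨅ (v : ℕ → X → ℝ) (g : ℕ → X → ℝ≥0∞) (_ : ∀ i, MemN11Loc μ (v i) Ω)
    (_ : ∀ i, IsUpperGradientOn (g i) (v i) Ω) (_ : TendstoL1Loc μ v u Ω),
    liminf (fun i => ∫⁻ x in Ω, g i x ∂μ) atTop

/-- The total variation `‖Du‖(A)` of `u` in an arbitrary set `A`. -/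
def variation {X : Type*} [MetricSpace X] [MeasurableSpace X] (μ : Measure X)
    (u : X → ℝ) (A : Set X) : ℝ≥0∞ :=
  ⨅ (U : Set X) (_ : IsOpen U) (_ : A ⊆ U), openVariation μ u U

/-- `u ∈ BV(X)`. -/
def MemBV {X : Type*} [MetricSpace X] [MeasurableSpace X] (μ : Measure X) (u : X → ℝ) : Prop :=
  Integrable u μ ∧ openVariation μ u univ < ⊤

/-- `g ∈ BV_0(Ω)`: `g ∈ BV(X)` and `g = 0` a.e. in `X \ Ω`. -/
def MemBV0 {X : Type*} [MetricSpace X] [MeasurableSpace X] (μ : Measure X)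
    (g : X → ℝ) (Ω : Set X) : Prop :=
  MemBV μ g ∧ ∀ᵐ x ∂μ, x ∉ Ω → g x = 0

/-- `u ∈ BV(X)` is a solution to the Dirichlet problem for least gradients in `Ω` with boundary
data `f`. -/
structure IsDirichletSolution {X : Type*} [MetricSpace X] [MeasurableSpace X] (μ : Measure X)
    (Ω : Set X) (f u : X → ℝ) : Prop where
  memBV : MemBV μ u
  sub_memBV0 : MemBV0 μ (fun x => u x - f x) Ω
  minimal : ∀ g : X → ℝ, MemBV0 μ g Ω →
    variation μ u (closure Ω) ≤ variation μ (fun x => u x + g x) (closure Ω)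

/-- `μ` is doubling (at all scales), with positive and finite measure of balls. -/
def IsDoubling {X : Type*} [MetricSpace X] [MeasurableSpace X] (μ : Measure X) : Prop :=
  ∃ c : ℝ, 0 < c ∧ ∀ (x : X) (r : ℝ), 0 < r →
    0 < μ (Metric.ball x (2 * r)) ∧
    μ (Metric.ball x (2 * r)) ≤ ENNReal.ofReal c * μ (Metric.ball x r) ∧
    ENNReal.ofReal c * μ (Metric.ball x r) < ⊤

/-- `X` supports a `(1,1)`-Poincaré inequality. -/
def SupportsPoincare {X : Type*} [MetricSpace X] [MeasurableSpace X] (μ : Measure X) : Prop :=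
  ∃ c l : ℝ, 0 < c ∧ 1 ≤ l ∧ ∀ (x : X) (r : ℝ), 0 < r →
    ∀ (u : X → ℝ) (g : X → ℝ≥0∞), LocallyIntegrable u μ → IsUpperGradientOn g u univ →
      ⨍⁻ y in Metric.ball x r, ‖u y - ⨍ z in Metric.ball x r, u z ∂μ‖ₑ ∂μ ≤
        ENNReal.ofReal (c * r) * ⨍⁻ y in Metric.ball x (l * r), g y ∂μ

end

end LeastGradient

/-! For the upper bound with `M = M₂`, compare `u` with `min u M`: the difference `-(u - M)₊` lies
in `BV_0(Ω)` because `u = f ≤ M` a.e. outside `Ω`. Minimality bounds the variation of `u` on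
`closure Ω` by that of `(M - u)₊`. Since the variations of `(u - M)₊` and `(M - u)₊` add up to at
most that of `u` (`variation_posPart_add_le`), which is finite, `(u - M)₊` has zero variation on
`closure Ω`.

It remains to see that `W = min ((u - M)₊) 1`, which vanishes a.e. off `Ω`, is zero a.e. Its
approximants `v` live only on a neighbourhood `U` of `closure Ω`, whereas the Poincaré inequality
needs functions on all of `X`. With a Lipschitz cutoff `ψ`, zero on the relevant part of `closure Ω`
and above `1` off `U`, the function `(v - ψ)₊` extends by zero. The cutoff costs its Lipschitz
constant only on `{0 < ψ < 1, ψ < v}`, whose measure in a fixed ball tends to zero because `v → 0`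
there (`exists_approx_of_variation_closure_eq_zero`). Poincaré on balls meeting `Ωᶜ` in positive
measure then forces `W = 0` a.e. The lower bound is the upper bound for `-u`. -/

namespace LeastGradient

/-! ### Arc-length parametrization and upper gradients along unit-speed curves -/

section Curves

variable {X : Type*} [MetricSpace X]

theorem _root_.HasUnitSpeedOn.lipschitzOnWith {σ : ℝ → X} {s : Set ℝ} (h : HasUnitSpeedOn σ s) :
    LipschitzOnWith 1 σ s := by
  have key : ∀ x ∈ s, ∀ y ∈ s, x ≤ y → edist (σ x) (σ y) ≤ edist x y := by
    intro x hx y hy hxy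
    calc edist (σ x) (σ y) ≤ eVariationOn σ (s ∩ Icc x y) :=
          eVariationOn.edist_le _ ⟨hx, le_rfl, hxy⟩ ⟨hy, hxy, le_rfl⟩
      _ = ENNReal.ofReal (y - x) := by simpa using h hx hy
      _ = edist x y := by
          rw [edist_dist, Real.dist_eq, abs_sub_comm, abs_of_nonneg (sub_nonneg.2 hxy)]
  intro x hx y hy
  rw [ENNReal.coe_one, one_mul]
  rcases le_total x y with hxy | hxy
  · exact key x hx y hy hxy
  · rw [edist_comm, edist_comm x]
    exact key y hy x hx hxy

theorem _root_.HasUnitSpeedOn.mono_Icc {σ : ℝ → X} {a b s t : ℝ} (h : HasUnitSpeedOn σ (Icc a b))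
    (hs : a ≤ s) (ht : t ≤ b) : HasUnitSpeedOn σ (Icc s t) := by
  intro x hx y hy
  rw [← h ⟨hs.trans hx.1, hx.2.trans ht⟩ ⟨hs.trans hy.1, hy.2.trans ht⟩]
  congr 1
  rw [Icc_inter_Icc, Icc_inter_Icc, sup_of_le_right hx.1, inf_of_le_right hy.2,
    sup_of_le_right (hs.trans hx.1), inf_of_le_right (hy.2.trans ht)]

theorem _root_.HasUnitSpeedOn.eVariationOn_Icc {σ : ℝ → X} {s t : ℝ}
    (h : HasUnitSpeedOn σ (Icc s t)) (hst : s ≤ t) :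
    eVariationOn σ (Icc s t) = ENNReal.ofReal (t - s) := by
  have := h (left_mem_Icc.2 hst) (right_mem_Icc.2 hst)
  simpa using this

/-- Arc length from `s` to `s + r` is exactly `r`, so the natural parametrization is a translation
of `σ`. -/
theorem lineIntegral_of_hasUnitSpeedOn (g : X → ℝ≥0∞) {σ : ℝ → X} {s t : ℝ} (hst : s ≤ t)
    (h : HasUnitSpeedOn σ (Icc s t)) :
    lineIntegral g σ s t = ∫⁻ r in Icc s t, g (σ r) := by
  have hv := (hasConstantSpeedOnWith_iff_variationOnFromTo_eq.1 h).2
  unfold lineIntegral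
  rw [h.eVariationOn_Icc hst, ENNReal.toReal_ofReal (sub_nonneg.2 hst)]
  have hpre : (fun r => s + r) ⁻¹' Icc s t = Icc 0 (t - s) := by
    ext r
    simp only [mem_preimage, mem_Icc]
    constructor <;> rintro ⟨h1, h2⟩ <;> constructor <;> linarith
  rw [← (measurePreserving_add_left volume s).setLIntegral_comp_preimage_emb
    (measurableEmbedding_addLeft s) (fun r => g (σ r)) (Icc s t), hpre]
  refine setLIntegral_congr_fun measurableSet_Icc fun r hr => ?_
  have hmem : s + r ∈ Icc s t := ⟨by linarith [hr.1], by linarith [hr.2]⟩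
  have hex : ∃ a ∈ Icc s t, variationOnFromTo σ (Icc s t) s a = r :=
    ⟨s + r, hmem, by rw [hv (left_mem_Icc.2 hst) hmem]; simp⟩
  have : Nonempty ℝ := ⟨s⟩
  have h1 := Function.invFunOn_mem hex
  have h2 := Function.invFunOn_eq hex
  rw [hv (left_mem_Icc.2 hst) h1] at h2
  simp only [naturalParameterization, Function.comp]
  congr 2
  simp only [NNReal.coe_one, one_mul] at h2
  linarith

/-- By continuity of `γ`, its variation on short intervals to the left and right of a point tends to
zero. -/
theorem continuousOn_variationOnFromTo {γ : ℝ → X} {a b : ℝ} (h : IsCurve γ a b) :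
    ContinuousOn (variationOnFromTo γ (Icc a b) a) (Icc a b) := by
  intro x hx
  have hb : BoundedVariationOn γ (Icc a b) := h.rectifiable
  have hl : LocallyBoundedVariationOn γ (Icc a b) := hb.locallyBoundedVariationOn
  have h1 := hb.tendsto_eVariationOn_Icc_zero_left
    (x := x) ((h.continuousOn x hx).mono inter_subset_left)
  have h2 := hb.tendsto_eVariationOn_Icc_zero_right x ((h.continuousOn x hx).mono inter_subset_left)
  have h3 := (ENNReal.continuousAt_toReal ENNReal.zero_ne_top).tendsto.comp h1
  have h4 := (ENNReal.continuousAt_toReal ENNReal.zero_ne_top).tendsto.comp h2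
  have h5 := h3.add h4
  rw [ENNReal.toReal_zero, add_zero] at h5
  rw [ContinuousWithinAt, tendsto_iff_dist_tendsto_zero]
  refine squeeze_zero' (Eventually.of_forall fun _ => dist_nonneg) ?_ h5
  filter_upwards [self_mem_nhdsWithin] with y hy
  have hadd := variationOnFromTo.add hl (left_mem_Icc.2 h.le) hx hy
  have hsub : variationOnFromTo γ (Icc a b) a y - variationOnFromTo γ (Icc a b) a x =
      variationOnFromTo γ (Icc a b) x y := by linarith
  rw [Real.dist_eq, hsub]
  simp only [Function.comp]
  rcases le_total x y with hxy | hxy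
  · rw [variationOnFromTo.eq_of_le _ _ hxy, abs_of_nonneg ENNReal.toReal_nonneg]
    linarith [ENNReal.toReal_nonneg (a := eVariationOn γ (Icc a b ∩ Icc y x))]
  · rw [variationOnFromTo.eq_of_ge _ _ hxy, abs_neg, abs_of_nonneg ENNReal.toReal_nonneg]
    linarith [ENNReal.toReal_nonneg (a := eVariationOn γ (Icc a b ∩ Icc x y))]

/-- The arc-length parametrization of a curve has unit speed on `[0, ℓ]`, the same end points and
the same image. -/
theorem IsCurve.naturalParameterization {γ : ℝ → X} {a b : ℝ} (h : IsCurve γ a b) :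
    HasUnitSpeedOn (naturalParameterization γ (Icc a b) a)
      (Icc 0 (eVariationOn γ (Icc a b)).toReal) ∧
    naturalParameterization γ (Icc a b) a 0 = γ a ∧
    naturalParameterization γ (Icc a b) a (eVariationOn γ (Icc a b)).toReal = γ b ∧
    ∀ t ∈ Icc 0 (eVariationOn γ (Icc a b)).toReal,
      ∃ r ∈ Icc a b, naturalParameterization γ (Icc a b) a t = γ r := by
  have ha := left_mem_Icc.2 h.le
  have hb := right_mem_Icc.2 h.le
  have hl : LocallyBoundedVariationOn γ (Icc a b) :=
    BoundedVariationOn.locallyBoundedVariationOn h.rectifiable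
  have hva : variationOnFromTo γ (Icc a b) a a = 0 := variationOnFromTo.self _ _ _
  have hvb : variationOnFromTo γ (Icc a b) a b = (eVariationOn γ (Icc a b)).toReal := by
    rw [variationOnFromTo.eq_of_le _ _ h.le, inter_self]
  have himage : variationOnFromTo γ (Icc a b) a '' Icc a b =
      Icc 0 (eVariationOn γ (Icc a b)).toReal := by
    apply Subset.antisymm
    · rintro _ ⟨x, hx, rfl⟩
      rw [← hva, ← hvb]
      exact ⟨variationOnFromTo.monotoneOn hl ha ha hx hx.1,
        variationOnFromTo.monotoneOn hl ha hx hb hx.2⟩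
    · rw [← hva, ← hvb]
      exact intermediate_value_Icc h.le (continuousOn_variationOnFromTo h)
  refine ⟨?_, ?_, ?_, ?_⟩
  · rw [← himage]
    exact has_unit_speed_naturalParameterization γ hl ha
  · have := edist_naturalParameterization_eq_zero hl ha ha
    rwa [hva, edist_eq_zero] at this
  · have := edist_naturalParameterization_eq_zero hl ha hb
    rwa [hvb, edist_eq_zero] at this
  · intro t ht
    rw [← himage] at ht
    obtain ⟨r, hr, rfl⟩ := ht
    exact ⟨r, hr, edist_eq_zero.1 (edist_naturalParameterization_eq_zero hl ha hr)⟩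

variable [MeasurableSpace X]

theorem IsUpperGradientOn.le_setLIntegral {g : X → ℝ≥0∞} {u : X → ℝ} {Ω : Set X}
    (hg : IsUpperGradientOn g u Ω) {σ : ℝ → X} {s t : ℝ} (hst : s ≤ t)
    (hσ : HasUnitSpeedOn σ (Icc s t)) (hΩ : ∀ r ∈ Icc s t, σ r ∈ Ω) :
    ENNReal.ofReal |u (σ s) - u (σ t)| ≤ ∫⁻ r in Icc s t, g (σ r) := by
  rw [← lineIntegral_of_hasUnitSpeedOn g hst hσ]
  refine hg.le_lineIntegral σ s t ⟨hst, hσ.lipschitzOnWith.continuousOn, ?_⟩ hΩ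
  rw [hσ.eVariationOn_Icc hst]
  exact ENNReal.ofReal_ne_top

/-- Reparametrization by arc length preserves end points and image, so unit-speed curves suffice. -/
theorem isUpperGradientOn_of_hasUnitSpeedOn {g : X → ℝ≥0∞} {u : X → ℝ} {Ω : Set X}
    (hg : Measurable g)
    (h : ∀ (σ : ℝ → X) (l : ℝ), 0 ≤ l → HasUnitSpeedOn σ (Icc 0 l) → (∀ r ∈ Icc 0 l, σ r ∈ Ω) →
      ENNReal.ofReal |u (σ 0) - u (σ l)| ≤ ∫⁻ r in Icc 0 l, g (σ r)) :
    IsUpperGradientOn g u Ω := by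
  refine ⟨hg, fun γ a b hγ hΩ => ?_⟩
  obtain ⟨h1, h2, h3, h4⟩ := hγ.naturalParameterization
  have := h _ _ ENNReal.toReal_nonneg h1 (fun r hr => by
    obtain ⟨q, hq, hqr⟩ := h4 r hr
    exact hqr ▸ hΩ q hq)
  rwa [h2, h3] at this

theorem IsUpperGradientOn.comp {g : X → ℝ≥0∞} {u : X → ℝ} {Ω : Set X}
    (hg : IsUpperGradientOn g u Ω) {φ : ℝ → ℝ} (hφ : LipschitzWith 1 φ) :
    IsUpperGradientOn g (fun x => φ (u x)) Ω := by
  refine ⟨hg.measurable, fun γ a b hγ hm => le_trans ?_ (hg.le_lineIntegral γ a b hγ hm)⟩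
  refine ENNReal.ofReal_le_ofReal ?_
  simpa [Real.dist_eq] using hφ.dist_le_mul (u (γ a)) (u (γ b))

end Curves

/-! ### One-variable estimates localized to the positivity set -/

section RealLine

/-- This is absolute continuity of the integral of `k`. -/
theorem continuousOn_of_ofReal_abs_sub_le_setLIntegral {F : ℝ → ℝ} {k : ℝ → ℝ≥0∞} {a b : ℝ}
    (hk : ∫⁻ r in Icc a b, k r ≠ ⊤)
    (h : ∀ s t, a ≤ s → s ≤ t → t ≤ b →
      ENNReal.ofReal |F s - F t| ≤ ∫⁻ r in Icc s t, k r) :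
    ContinuousOn F (Icc a b) := by
  intro x hx
  have hvol : Tendsto (fun y => volume (uIcc x y)) (𝓝[Icc a b] x) (𝓝 0) := by
    have : Tendsto (fun y => ENNReal.ofReal |y - x|) (𝓝 x) (𝓝 (ENNReal.ofReal |x - x|)) :=
      (ENNReal.continuous_ofReal.comp (by fun_prop : Continuous fun y : ℝ => |y - x|)).tendsto x
    simp only [sub_self, abs_zero, ENNReal.ofReal_zero] at this
    simpa only [Real.volume_interval] using this.mono_left nhdsWithin_le_nhds
  have hint : Tendsto (fun y => ∫⁻ r in uIcc x y, k r ∂(volume.restrict (Icc a b)))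
      (𝓝[Icc a b] x) (𝓝 0) := by
    refine tendsto_setLIntegral_zero hk ?_
    exact tendsto_of_tendsto_of_tendsto_of_le_of_le tendsto_const_nhds hvol
      (fun _ => zero_le) fun _ => Measure.restrict_apply_le _ _
  have hbound : ∀ y ∈ Icc a b, edist (F y) (F x) ≤
      ∫⁻ r in uIcc x y, k r ∂(volume.restrict (Icc a b)) := by
    intro y hy
    rw [Measure.restrict_restrict measurableSet_uIcc,
      inter_eq_left.2 (uIcc_subset_Icc hx hy), edist_dist, Real.dist_eq]
    rcases le_total x y with hxy | hxy
    · rw [uIcc_of_le hxy, abs_sub_comm]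
      exact h x y hx.1 hxy hy.2
    · rw [uIcc_of_ge hxy]
      exact h y x hy.1 hxy hx.2
  rw [ContinuousWithinAt, tendsto_iff_edist_tendsto_0]
  refine tendsto_of_tendsto_of_tendsto_of_le_of_le' tendsto_const_nhds hint
    (Eventually.of_forall fun _ => zero_le) ?_
  filter_upwards [self_mem_nhdsWithin] with y hy using hbound y hy

/-- If a nonnegative continuous function starts at a positive value, the drop of its value until it
first vanishes is controlled on the set where it is positive. -/
theorem ofReal_le_setLIntegral_of_exists_eq_zero {F : ℝ → ℝ} {k : ℝ → ℝ≥0∞} {a b : ℝ}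
    (hF0 : ∀ r ∈ Icc a b, 0 ≤ F r) (hF : ContinuousOn F (Icc a b)) (hz : ∃ r ∈ Icc a b, F r = 0)
    (h : ∀ t, t ≤ b → a ≤ t → (∀ r ∈ Icc a t, 0 < F r) →
      ENNReal.ofReal |F a - F t| ≤ ∫⁻ r in Icc a t, k r) :
    ENNReal.ofReal (F a) ≤ ∫⁻ r in Icc a b ∩ {r | 0 < F r}, k r := by
  obtain ⟨r₀, hr₀, hr₀z⟩ := hz
  have hcl : IsClosed (Icc a b ∩ F ⁻¹' {0}) := hF.preimage_isClosed_of_isClosed isClosed_Icc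
    isClosed_singleton
  have hcomp : IsCompact (Icc a b ∩ F ⁻¹' {0}) :=
    isCompact_Icc.of_isClosed_subset hcl inter_subset_left
  -- `τ` is the first zero. The hypothesis applies only on `[a, t]` with `t < τ`; continuity then
  -- lets `t` tend to `τ`.
  obtain ⟨τ, ⟨hτ, hτz⟩, hmin⟩ := hcomp.exists_isLeast ⟨r₀, hr₀, hr₀z⟩
  have hτz' : F τ = 0 := hτz
  have hpos : ∀ r ∈ Ico a τ, 0 < F r := by
    intro r hr
    have hrm : r ∈ Icc a b := ⟨hr.1, hr.2.le.trans hτ.2⟩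
    refine lt_of_le_of_ne (hF0 r hrm) fun h0 => ?_
    exact absurd (hmin ⟨hrm, h0.symm⟩) (not_le.2 hr.2)
  rcases hτ.1.eq_or_lt with rfl | haτ
  · rw [hτz', ENNReal.ofReal_zero]; exact zero_le
  have hstep : ∀ t ∈ Ico a τ,
      ENNReal.ofReal (F a - F t) ≤ ∫⁻ r in Icc a b ∩ {r | 0 < F r}, k r := by
    intro t ht
    refine (ENNReal.ofReal_le_ofReal (le_abs_self _)).trans ((h t (ht.2.le.trans hτ.2) ht.1
      fun r hr => hpos r ⟨hr.1, hr.2.trans_lt ht.2⟩).trans (lintegral_mono_set ?_))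
    exact fun r hr => ⟨⟨hr.1, hr.2.trans (ht.2.le.trans hτ.2)⟩, hpos r ⟨hr.1, hr.2.trans_lt ht.2⟩⟩
  have hlim : Tendsto (fun t => ENNReal.ofReal (F a - F t)) (𝓝[Ico a τ] τ)
      (𝓝 (ENNReal.ofReal (F a - F τ))) := by
    refine (ENNReal.continuous_ofReal.tendsto _).comp (tendsto_const_nhds.sub ?_)
    exact (hF τ hτ).mono fun r hr => ⟨hr.1, hr.2.le.trans hτ.2⟩
  rw [hτz', sub_zero] at hlim
  have : (𝓝[Ico a τ] τ).NeBot := by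
    rw [← mem_closure_iff_nhdsWithin_neBot, closure_Ico haτ.ne]
    exact right_mem_Icc.2 haτ.le
  refine le_of_tendsto hlim ?_
  filter_upwards [self_mem_nhdsWithin] with t ht using hstep t ht

theorem ofReal_le_setLIntegral_of_exists_eq_zero' {F : ℝ → ℝ} {k : ℝ → ℝ≥0∞} {a b : ℝ}
    (hF0 : ∀ r ∈ Icc a b, 0 ≤ F r) (hF : ContinuousOn F (Icc a b)) (hz : ∃ r ∈ Icc a b, F r = 0)
    (h : ∀ s, a ≤ s → s ≤ b → (∀ r ∈ Icc s b, 0 < F r) →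
      ENNReal.ofReal |F s - F b| ≤ ∫⁻ r in Icc s b, k r) :
    ENNReal.ofReal (F b) ≤ ∫⁻ r in Icc a b ∩ {r | 0 < F r}, k r := by
  have hneg : ∀ (S : Set ℝ), ∫⁻ r in -S, k (-r) = ∫⁻ r in S, k r := fun S =>
    (Measure.measurePreserving_neg volume).setLIntegral_comp_preimage_emb
      (MeasurableEquiv.neg ℝ).measurableEmbedding k S
  have hIcc : ∀ s t : ℝ, -Icc s t = Icc (-t) (-s) := fun s t => by simp
  have key := ofReal_le_setLIntegral_of_exists_eq_zero (F := fun r => F (-r))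
    (k := fun r => k (-r)) (a := -b) (b := -a)
    (fun r hr => hF0 _ ⟨by linarith [hr.2], by linarith [hr.1]⟩)
    (hF.comp continuous_neg.continuousOn fun r hr => ⟨by linarith [hr.2], by linarith [hr.1]⟩)
    (by
      obtain ⟨r, hr, hr0⟩ := hz
      exact ⟨-r, ⟨by linarith [hr.2], by linarith [hr.1]⟩, by simpa using hr0⟩)
    (by
      intro t ht1 ht2 hp
      have := h (-t) (by linarith) (by linarith) fun r hr => by
        simpa using hp (-r) ⟨by linarith [hr.2], by linarith [hr.1]⟩
      rw [← hneg, hIcc, neg_neg, abs_sub_comm] at this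
      simpa using this)
  simp only [neg_neg] at key
  refine key.trans (le_of_eq ?_)
  rw [← hneg (Icc a b ∩ _), inter_neg, hIcc]
  rfl

/-- If `F` has a zero, the larger end value alone dominates `|F a - F b|`, and it is controlled on
the way to the nearest zero. -/
theorem ofReal_abs_sub_le_setLIntegral_pos {F : ℝ → ℝ} {k : ℝ → ℝ≥0∞} {a b : ℝ} (hab : a ≤ b)
    (hF0 : ∀ r ∈ Icc a b, 0 ≤ F r) (hF : ContinuousOn F (Icc a b))
    (h : ∀ s t, a ≤ s → s ≤ t → t ≤ b → (∀ r ∈ Icc s t, 0 < F r) →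
      ENNReal.ofReal |F s - F t| ≤ ∫⁻ r in Icc s t, k r) :
    ENNReal.ofReal |F a - F b| ≤ ∫⁻ r in Icc a b ∩ {r | 0 < F r}, k r := by
  by_cases hz : ∃ r ∈ Icc a b, F r = 0
  · have ha := hF0 a (left_mem_Icc.2 hab)
    have hb := hF0 b (right_mem_Icc.2 hab)
    rcases le_total (F a) (F b) with hle | hle
    · refine (ENNReal.ofReal_le_ofReal ?_).trans (ofReal_le_setLIntegral_of_exists_eq_zero' hF0 hF
        hz fun s hs hsb hp => h s b hs hsb le_rfl hp)
      rw [abs_sub_comm, abs_of_nonneg (sub_nonneg.2 hle)]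
      linarith
    · refine (ENNReal.ofReal_le_ofReal ?_).trans (ofReal_le_setLIntegral_of_exists_eq_zero hF0 hF
        hz fun t ht hat hp => h a t le_rfl hat ht hp)
      rw [abs_of_nonneg (sub_nonneg.2 hle)]
      linarith
  · push Not at hz
    have hp : ∀ r ∈ Icc a b, 0 < F r := fun r hr => lt_of_le_of_ne (hF0 r hr) (hz r hr).symm
    rw [inter_eq_left.2 (show Icc a b ⊆ {r | 0 < F r} from hp)]
    exact h a b le_rfl hab le_rfl hp

end RealLine

end LeastGradient

namespace LeastGradient

/-! ### Upper gradients of truncated and glued functions -/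

section UpperGradients

/-- Continuity makes `{F > 0}` measurable in `[a, b]`, so the integrands need be compared only
there. -/
theorem ofReal_abs_sub_le_setLIntegral_of_le_of_pos {F : ℝ → ℝ} {k k' : ℝ → ℝ≥0∞} {a b : ℝ}
    (hab : a ≤ b) (hF0 : ∀ r ∈ Icc a b, 0 ≤ F r) (hF : ContinuousOn F (Icc a b))
    (h : ∀ s t, a ≤ s → s ≤ t → t ≤ b → (∀ r ∈ Icc s t, 0 < F r) →
      ENNReal.ofReal |F s - F t| ≤ ∫⁻ r in Icc s t, k r)
    (hk : ∀ r ∈ Icc a b, 0 < F r → k r ≤ k' r) :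
    ENNReal.ofReal |F a - F b| ≤ ∫⁻ r in Icc a b, k' r := by
  have hmeas : MeasurableSet (Icc a b ∩ {r | 0 < F r}) := by
    obtain ⟨O, hO, hOF⟩ := continuousOn_iff'.1 hF (Ioi 0) isOpen_Ioi
    have : Icc a b ∩ {r | 0 < F r} = O ∩ Icc a b := by rw [← hOF, inter_comm]; rfl
    rw [this]
    exact hO.measurableSet.inter measurableSet_Icc
  calc ENNReal.ofReal |F a - F b| ≤ ∫⁻ r in Icc a b ∩ {r | 0 < F r}, k r :=
        ofReal_abs_sub_le_setLIntegral_pos hab hF0 hF h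
    _ ≤ ∫⁻ r in Icc a b ∩ {r | 0 < F r}, k' r :=
        setLIntegral_mono' hmeas fun r hr => hk r hr.1 hr.2
    _ ≤ ∫⁻ r in Icc a b, k' r := lintegral_mono_set inter_subset_left

variable {X : Type*} [MetricSpace X] [MeasurableSpace X]

theorem IsUpperGradientOn.continuousOn_comp {g : X → ℝ≥0∞} {u : X → ℝ} {Ω : Set X}
    (hg : IsUpperGradientOn g u Ω) {σ : ℝ → X} {a b : ℝ}
    (hσ : HasUnitSpeedOn σ (Icc a b)) (hΩ : ∀ r ∈ Icc a b, σ r ∈ Ω)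
    (hfin : ∫⁻ r in Icc a b, g (σ r) ≠ ⊤) :
    ContinuousOn (fun r => u (σ r)) (Icc a b) :=
  continuousOn_of_ofReal_abs_sub_le_setLIntegral hfin fun _ _ hs hst ht =>
    hg.le_setLIntegral hst (hσ.mono_Icc hs ht) fun r hr => hΩ r ⟨hs.trans hr.1, hr.2.trans ht⟩

/-- The positive part of `v - M` has an upper gradient concentrated, up to a small multiple of `g`,
on the set where `v > M`. -/
theorem IsUpperGradientOn.posPart_sub_const {g : X → ℝ≥0∞} {v : X → ℝ} {Ω S : Set X}
    (hg : IsUpperGradientOn g v Ω) (M : ℝ) (hS : MeasurableSet S)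
    (hvS : ∀ x ∈ Ω, M < v x → x ∈ S) {ε : ℝ≥0∞} (hε : ε ≠ 0) :
    IsUpperGradientOn (fun x => S.indicator g x + ε * g x) (fun x => max (v x - M) 0) Ω := by
  refine isUpperGradientOn_of_hasUnitSpeedOn
    ((hg.measurable.indicator hS).add (hg.measurable.const_mul ε)) fun σ l hl hσ hΩ => ?_
  -- Without finiteness `v ∘ σ` may be discontinuous; the term `ε * g` makes the bound trivial on
  -- such curves.
  by_cases hfin : ∫⁻ r in Icc 0 l, g (σ r) = ⊤
  · refine le_top.trans ?_
    calc (⊤ : ℝ≥0∞) = ε * ∫⁻ r in Icc 0 l, g (σ r) := by rw [hfin, ENNReal.mul_top hε]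
      _ ≤ ∫⁻ r in Icc 0 l, ε * g (σ r) := lintegral_const_mul_le _ _
      _ ≤ _ := lintegral_mono fun r => le_add_self
  · have hc := hg.continuousOn_comp hσ hΩ hfin
    refine ofReal_abs_sub_le_setLIntegral_of_le_of_pos (F := fun r => max (v (σ r) - M) 0)
      (k := fun r => g (σ r)) hl (fun r _ => le_max_right _ _)
      (ContinuousOn.sup (hc.sub continuousOn_const) continuousOn_const) ?_ ?_
    · intro s t hs hst ht _
      refine le_trans (ENNReal.ofReal_le_ofReal ?_) (hg.le_setLIntegral hst (hσ.mono_Icc hs ht)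
        fun r hr => hΩ r ⟨hs.trans hr.1, hr.2.trans ht⟩)
      refine (abs_max_sub_max_le_abs _ _ _).trans (le_of_eq ?_)
      congr 1
      ring
    · intro r hr hp
      have : M < v (σ r) := by
        by_contra hcon
        rw [max_eq_right (by linarith)] at hp
        exact lt_irrefl _ hp
      rw [indicator_of_mem (hvS _ (hΩ r hr) this)]
      exact le_self_add

/-- Gluing with zero along a Lipschitz cutoff: subtracting `ψ` from `v` and truncating at `0` turns
a function on `U` into one on the whole space. -/
theorem IsUpperGradientOn.indicator_posPart_sub [BorelSpace X] {g : X → ℝ≥0∞} {v ψ : X → ℝ}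
    {U E : Set X} (hU : IsOpen U) (hg : IsUpperGradientOn g v U) (hv : ∀ x, v x ≤ 1)
    {L : NNReal} (hψ : LipschitzWith L ψ) (hψ0 : ∀ x, 0 ≤ ψ x) (hψU : ∀ x, ψ x ≤ 1 → x ∈ U)
    (hE : MeasurableSet E) (hvE : ∀ x, ψ x < 1 → 0 < ψ x → ψ x < v x → x ∈ E) :
    IsUpperGradientOn (fun x => U.indicator g x + E.indicator (fun _ => (L : ℝ≥0∞)) x)
      ({x | ψ x < 1}.indicator fun x => max (v x - ψ x) 0) univ := by
  refine isUpperGradientOn_of_hasUnitSpeedOn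
    ((hg.measurable.indicator hU.measurableSet).add (measurable_const.indicator hE))
    fun σ l hl hσ _ => ?_
  by_cases hfin : ∫⁻ r in Icc 0 l, U.indicator g (σ r) = ⊤
  · refine le_top.trans ?_
    rw [← hfin]
    exact lintegral_mono fun r => le_self_add
  set V : X → ℝ := {x | ψ x < 1}.indicator fun x => max (v x - ψ x) 0 with hV
  have hσc : ContinuousOn σ (Icc 0 l) := hσ.lipschitzOnWith.continuousOn
  have hψc : ContinuousOn (fun r => ψ (σ r)) (Icc 0 l) := hψ.continuous.comp_continuousOn hσc
  -- As `v ≤ 1`, the positive part already vanishes where `ψ ≥ 1`.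
  have hVeq : ∀ x, V x = max (v x - ψ x) 0 := by
    intro x
    by_cases h : ψ x < 1
    · exact indicator_of_mem (s := {x | ψ x < 1}) h _
    · rw [hV, indicator_of_notMem (by exact h), max_eq_right (by linarith [hv x])]
  have hV0 : ∀ x, 0 ≤ V x := fun x => by rw [hVeq]; exact le_max_right _ _
  have hVpos : ∀ x, 0 < V x → ψ x < 1 ∧ ψ x < v x := by
    intro x hx
    rw [hVeq] at hx
    have : ψ x < v x := by
      by_contra hcon
      rw [max_eq_right (by linarith)] at hx
      exact lt_irrefl _ hx
    exact ⟨this.trans_le (hv x), this⟩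
  -- Near a point of `U`, a short subcurve stays in `U` and `v` is continuous along it; off `U`, `ψ
  -- > 1`, so `V` vanishes nearby along the curve.
  have hcont : ContinuousOn (fun r => V (σ r)) (Icc 0 l) := by
    intro r hr
    by_cases hrU : σ r ∈ U
    · obtain ⟨η, hη, hball⟩ : ∃ η > 0, ∀ q ∈ Icc 0 l, q ∈ Metric.closedBall r η → σ q ∈ U := by
        have : σ ⁻¹' U ∈ 𝓝[Icc 0 l] r := hσc r hr (hU.mem_nhds hrU)
        obtain ⟨η, hη, hs⟩ := Metric.mem_nhdsWithin_iff.1 this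
        exact ⟨η / 2, half_pos hη, fun q hq hqb => hs ⟨Metric.closedBall_subset_ball
          (half_lt_self hη) hqb, hq⟩⟩
      rw [Real.closedBall_eq_Icc] at hball
      set a := max 0 (r - η)
      set b := min l (r + η)
      have hsub : Icc a b ⊆ Icc 0 l := Icc_subset_Icc (le_max_left _ _) (min_le_left _ _)
      have hin : ∀ q ∈ Icc a b, σ q ∈ U := fun q hq => hball q (hsub hq)
        ⟨(le_max_right _ _).trans hq.1, hq.2.trans (min_le_right _ _)⟩
      have hc := hg.continuousOn_comp (hσ.mono_Icc (le_max_left _ _) (min_le_left _ _)) hin (by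
        refine ne_top_of_le_ne_top hfin ?_
        calc ∫⁻ q in Icc a b, g (σ q) = ∫⁻ q in Icc a b, U.indicator g (σ q) :=
              setLIntegral_congr_fun measurableSet_Icc fun q hq =>
                (indicator_of_mem (hin q hq) g).symm
          _ ≤ _ := lintegral_mono_set hsub)
      have hra : r ∈ Icc a b :=
        ⟨max_le hr.1 (by linarith), le_min hr.2 (by linarith)⟩
      have hnhds : Icc a b ∈ 𝓝[Icc 0 l] r := by
        have h1 : Icc (r - η) (r + η) ∈ 𝓝 r := Icc_mem_nhds (by linarith) (by linarith)
        filter_upwards [self_mem_nhdsWithin, nhdsWithin_le_nhds h1] with q hq1 hq2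
        exact ⟨max_le hq1.1 hq2.1, le_min hq1.2 hq2.2⟩
      have hc' : ContinuousWithinAt (fun q => v (σ q)) (Icc 0 l) r :=
        (hc r hra).mono_of_mem_nhdsWithin hnhds
      simp only [hVeq]
      exact (hc'.sub (hψc r hr)).max continuousWithinAt_const
    · have h1 : 1 < ψ (σ r) := by
        by_contra hcon
        exact hrU (hψU _ (not_lt.1 hcon))
      have : ∀ᶠ q in 𝓝[Icc 0 l] r, 1 < ψ (σ q) := (hψc r hr).eventually (lt_mem_nhds h1)
      have hz : ∀ x, 1 < ψ x → V x = 0 := fun x hx => indicator_of_notMem (by simpa using hx.le) _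
      refine ContinuousWithinAt.congr_of_eventuallyEq (f := fun _ => (0 : ℝ))
        continuousWithinAt_const ?_ (hz _ h1)
      filter_upwards [this] with q hq using hz _ hq
  -- Applying the positivity-set estimate to `ψ` itself removes the cost `L` where `ψ = 0`.
  have hψσ : ∀ s t, 0 ≤ s → s ≤ t → t ≤ l → ENNReal.ofReal |ψ (σ s) - ψ (σ t)| ≤
      ∫⁻ r in Icc s t, {x | 0 < ψ x}.indicator (fun _ => (L : ℝ≥0∞)) (σ r) := by
    intro s t hs hst ht
    have hsub : Icc s t ⊆ Icc 0 l := Icc_subset_Icc hs ht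
    refine ofReal_abs_sub_le_setLIntegral_of_le_of_pos (F := fun r => ψ (σ r))
      (k := fun _ => (L : ℝ≥0∞)) hst (fun r _ => hψ0 _) (hψc.mono hsub) ?_ ?_
    · intro p q hp hpq hq _
      have h1 := hψ.edist_le_mul (σ p) (σ q)
      have h2 := (hσ.mono_Icc hs ht).lipschitzOnWith ⟨hp, hpq.trans hq⟩ ⟨hp.trans hpq, hq⟩
      rw [ENNReal.coe_one, one_mul] at h2
      rw [setLIntegral_const, Real.volume_Icc, ← Real.dist_eq, ← edist_dist]
      refine h1.trans (mul_le_mul_right (h2.trans (le_of_eq ?_)) _)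
      rw [edist_dist, Real.dist_eq, abs_sub_comm, abs_of_nonneg (sub_nonneg.2 hpq)]
    · intro r _ hp
      rw [indicator_of_mem (show σ r ∈ {x | 0 < ψ x} from hp)]
  refine ofReal_abs_sub_le_setLIntegral_of_le_of_pos (F := fun r => V (σ r))
    (k := fun r => U.indicator g (σ r) + {x | 0 < ψ x}.indicator (fun _ => (L : ℝ≥0∞)) (σ r))
    hl (fun r _ => hV0 _) hcont ?_ ?_
  · intro s t hs hst ht hp
    have hin : ∀ r ∈ Icc s t, σ r ∈ U := fun r hr => hψU _ (hVpos _ (hp r hr)).1.le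
    have h1 := hg.le_setLIntegral hst (hσ.mono_Icc hs ht) hin
    have h2 : ∫⁻ r in Icc s t, g (σ r) = ∫⁻ r in Icc s t, U.indicator g (σ r) :=
      setLIntegral_congr_fun measurableSet_Icc fun q hq => (indicator_of_mem (hin q hq) g).symm
    rw [h2] at h1
    refine le_trans ?_ ((add_le_add h1 (hψσ s t hs hst ht)).trans (le_lintegral_add _ _))
    rw [← ENNReal.ofReal_add (abs_nonneg _) (abs_nonneg _)]
    refine ENNReal.ofReal_le_ofReal ?_
    rw [hVeq, hVeq]
    refine (abs_max_sub_max_le_abs _ _ _).trans ?_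
    calc |v (σ s) - ψ (σ s) - (v (σ t) - ψ (σ t))|
        = |(v (σ s) - v (σ t)) - (ψ (σ s) - ψ (σ t))| := by congr 1; ring
      _ ≤ _ := abs_sub _ _
  · intro r _ hp
    obtain ⟨h1, h2⟩ := hVpos _ hp
    refine add_le_add le_rfl ?_
    by_cases h0 : 0 < ψ (σ r)
    · rw [indicator_of_mem (hvE _ h1 h0 h2)]
      exact indicator_le_self _ _ _
    · rw [indicator_of_notMem (by exact h0)]
      exact zero_le

end UpperGradients

end LeastGradient

namespace LeastGradient

/-! ### Doubling measures and properness -/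

section Doubling

variable {X : Type*} [MetricSpace X] [MeasurableSpace X] {μ : Measure X}

theorem IsDoubling.measure_ball_pos (h : IsDoubling μ) (x : X) {r : ℝ} (hr : 0 < r) :
    0 < μ (Metric.ball x r) := by
  obtain ⟨c, _, h⟩ := h
  have := (h x (r / 2) (half_pos hr)).1
  rwa [mul_div_cancel₀ r two_ne_zero] at this

theorem IsDoubling.measure_ball_lt_top (h : IsDoubling μ) (x : X) (r : ℝ) :
    μ (Metric.ball x r) < ⊤ := by
  obtain ⟨c, _, h⟩ := h
  have hr : 0 < max r 1 / 2 := by positivity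
  have := (h x _ hr).2
  rw [mul_div_cancel₀ _ two_ne_zero] at this
  exact (measure_mono (Metric.ball_subset_ball (le_max_left _ _))).trans_lt
    (this.1.trans_lt this.2)

theorem IsDoubling.isFiniteMeasureOnCompacts (h : IsDoubling μ) : IsFiniteMeasureOnCompacts μ := by
  refine ⟨fun K hK => ?_⟩
  rcases K.eq_empty_or_nonempty with rfl | ⟨x, _⟩
  · simp
  · obtain ⟨r, hr⟩ := hK.isBounded.subset_ball x
    exact (measure_mono hr).trans_lt (h.measure_ball_lt_top x r)

theorem IsDoubling.exists_measure_ball_two_pow_le (h : IsDoubling μ) :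
    ∃ c : ℝ≥0∞, c ≠ ⊤ ∧ ∀ (x : X) (r : ℝ), 0 < r → ∀ n : ℕ,
      μ (Metric.ball x (2 ^ n * r)) ≤ c ^ n * μ (Metric.ball x r) := by
  obtain ⟨c, _, h⟩ := h
  refine ⟨ENNReal.ofReal c, ENNReal.ofReal_ne_top, fun x r hr n => ?_⟩
  induction n with
  | zero => simp
  | succ n ih =>
    have := (h x (2 ^ n * r) (by positivity)).2.1
    rw [← mul_assoc, ← pow_succ'] at this
    refine this.trans ?_
    rw [pow_succ', mul_assoc]
    exact mul_le_mul_right ih _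

/-- Otherwise an infinite `ε`-separated sequence gives disjoint balls of measure bounded below, by
doubling, inside one ball of finite measure. -/
theorem IsDoubling.totallyBounded_ball [OpensMeasurableSpace X] (h : IsDoubling μ) (x : X)
    (r : ℝ) : TotallyBounded (Metric.ball x r) := by
  rw [Metric.totallyBounded_iff]
  by_contra! hcon
  obtain ⟨ε, hε, hcon⟩ := hcon
  obtain ⟨f, hf1, hf2⟩ := exists_seq_of_forall_finset_exists (fun y => y ∈ Metric.ball x r)
    (fun y z => ε ≤ dist y z) fun s _ => by
      obtain ⟨y, hy, hys⟩ := not_subset.1 (hcon s s.finite_toSet)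
      refine ⟨y, hy, fun z hz => ?_⟩
      by_contra hlt
      exact hys (mem_biUnion hz (by rw [Metric.mem_ball, dist_comm]; exact not_le.1 hlt))
  obtain ⟨c, hc, hdoub⟩ := h.exists_measure_ball_two_pow_le
  have hr : 0 < r := Metric.pos_of_mem_ball (hf1 0)
  obtain ⟨n, hn⟩ : ∃ n : ℕ, 2 * r ≤ 2 ^ n * (ε / 2) := by
    obtain ⟨n, hn⟩ := pow_unbounded_of_one_lt (2 * r / (ε / 2)) (one_lt_two : (1 : ℝ) < 2)
    exact ⟨n, by rw [div_lt_iff₀ (by positivity)] at hn; exact hn.le⟩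
  have hlow : ∀ i, μ (Metric.ball x r) / c ^ n ≤ μ (Metric.ball (f i) (ε / 2)) := by
    intro i
    refine ENNReal.div_le_of_le_mul' ((measure_mono ?_).trans (hdoub (f i) (ε / 2)
      (by positivity) n))
    refine Metric.ball_subset_ball' ?_
    have := hf1 i
    rw [Metric.mem_ball, dist_comm] at this
    linarith
  have hdisj : Pairwise (Function.onFun Disjoint fun i => Metric.ball (f i) (ε / 2)) := by
    intro i j hij
    refine Metric.ball_disjoint_ball ?_
    rw [add_halves]
    rcases hij.lt_or_gt with hlt | hlt
    · exact hf2 i j hlt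
    · rw [dist_comm]; exact hf2 j i hlt
  have hpos : 0 < μ (Metric.ball x r) / c ^ n :=
    ENNReal.div_pos (h.measure_ball_pos x hr).ne' (ENNReal.pow_ne_top hc)
  have hfin := Measure.finite_const_le_meas_of_disjoint_iUnion μ hpos
    (fun i => Metric.isOpen_ball.measurableSet) hdisj (by
      refine ne_top_of_le_ne_top (h.measure_ball_lt_top x (r + ε)).ne (measure_mono ?_)
      refine iUnion_subset fun i => Metric.ball_subset_ball' ?_
      have := hf1 i
      rw [Metric.mem_ball] at this
      linarith)
  have huniv : {i : ℕ | μ (Metric.ball x r) / c ^ n ≤ μ (Metric.ball (f i) (ε / 2))} = univ :=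
    eq_univ_of_forall hlow
  rw [huniv] at hfin
  exact infinite_univ hfin

theorem IsDoubling.properSpace [CompleteSpace X] [OpensMeasurableSpace X] (h : IsDoubling μ) :
    ProperSpace X := by
  refine ⟨fun x r => ?_⟩
  refine (((h.totallyBounded_ball x (r + 1)).subset ?_).isCompact_of_isClosed
    Metric.isClosed_closedBall)
  exact Metric.closedBall_subset_ball (by linarith)

end Doubling

/-! ### Measurable envelopes of level regions -/

section Levels

variable {X : Type*} [MeasurableSpace X] {μ : Measure X}

theorem liminf_add_liminf_le (a b : ℕ → ℝ≥0∞) :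
    liminf a atTop + liminf b atTop ≤ liminf (fun i => a i + b i) atTop := by
  have hmono : ∀ c : ℕ → ℝ≥0∞, Monotone fun n => ⨅ i ≥ n, c i := fun c m n hmn =>
    le_iInf₂ fun i hi => iInf₂_le i (hmn.trans hi)
  rw [liminf_eq_iSup_iInf_of_nat, liminf_eq_iSup_iInf_of_nat, liminf_eq_iSup_iInf_of_nat,
    ENNReal.iSup_add_iSup_of_monotone (hmono a) (hmono b)]
  exact iSup_mono fun n => le_iInf₂ fun i hi => add_le_add (iInf₂_le i hi) (iInf₂_le i hi)

/-- The regions above and below a level of a measurable function have Borel envelopes on which the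
integrals of a fixed function add up to at most its total integral. -/
theorem exists_measurableSet_levels {v : X → ℝ} {Ω : Set X}
    (hv : AEStronglyMeasurable v (μ.restrict Ω)) (M : ℝ) :
    ∃ S T : Set X, MeasurableSet S ∧ MeasurableSet T ∧ (∀ x ∈ Ω, M < v x → x ∈ S) ∧
      (∀ x ∈ Ω, v x < M → x ∈ T) ∧ ∀ g : X → ℝ≥0∞,
      ∫⁻ x in Ω, S.indicator g x ∂μ + ∫⁻ x in Ω, T.indicator g x ∂μ ≤ ∫⁻ x in Ω, g x ∂μ := by
  obtain ⟨w, hw, hvw⟩ := hv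
  obtain ⟨N, hN, hNm, hN0⟩ := exists_measurable_superset_of_null hvw
  have hwm := hw.measurable
  have heq : ∀ x, x ∉ N → v x = w x := fun x hx => by
    by_contra hne
    exact hx (hN hne)
  have hS : MeasurableSet {x | M < w x} := measurableSet_lt measurable_const hwm
  have hT : MeasurableSet {x | w x < M} := measurableSet_lt hwm measurable_const
  -- `v` is only a.e. measurable; the Borel null set `N` absorbs all points where it differs from
  -- `w`.
  refine ⟨{x | M < w x} ∪ N, {x | w x < M} ∪ N, hS.union hNm, hT.union hNm, ?_, ?_, fun g => ?_⟩
  · intro x _ hx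
    by_cases h : x ∈ N
    · exact Or.inr h
    · exact Or.inl (by rw [mem_ofPred_eq, ← heq x h]; exact hx)
  · intro x _ hx
    by_cases h : x ∈ N
    · exact Or.inr h
    · exact Or.inl (by rw [mem_ofPred_eq, ← heq x h]; exact hx)
  · have hNae : ∀ A : Set X, (A ∪ N : Set X) =ᵐ[μ.restrict Ω] A := fun A =>
      union_ae_eq_left_of_ae_eq_empty (ae_eq_empty.2 hN0)
    rw [lintegral_congr_ae (indicator_ae_eq_of_ae_eq_set (hNae {x | M < w x})),
      lintegral_congr_ae (indicator_ae_eq_of_ae_eq_set (hNae {x | w x < M})),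
      lintegral_indicator hS, lintegral_indicator hT, ← lintegral_union hT]
    · exact setLIntegral_le_lintegral _ _
    · exact disjoint_left.2 fun x hx hx' => lt_asymm (mem_ofPred_eq ▸ hx) hx'

end Levels

/-! ### Total variation under Lipschitz maps and splitting at a level -/

section Variation

variable {X : Type*} [MetricSpace X] [MeasurableSpace X] {μ : Measure X}

theorem CompactlyInside.measure_lt_top [IsFiniteMeasureOnCompacts μ] {Ω' Ω : Set X}
    (h : CompactlyInside Ω' Ω) : μ Ω' < ⊤ :=
  (measure_mono subset_closure).trans_lt h.2.1.measure_lt_top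

theorem MemN11Loc.comp [IsFiniteMeasureOnCompacts μ] {v : X → ℝ} {Ω : Set X}
    (hv : MemN11Loc μ v Ω) {φ : ℝ → ℝ} (hφ : LipschitzWith 1 φ) :
    MemN11Loc μ (fun x => φ (v x)) Ω := by
  intro Ω' hΩ'
  obtain ⟨hint, g, hg, hgint⟩ := hv Ω' hΩ'
  refine ⟨?_, g, hg.comp hφ, hgint⟩
  have hconst : IntegrableOn (fun _ : X => ‖φ 0‖) Ω' μ :=
    integrableOn_const hΩ'.measure_lt_top.ne
  refine (hint.norm.add hconst).mono
    (hφ.continuous.comp_aestronglyMeasurable hint.aestronglyMeasurable) ?_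
  refine Eventually.of_forall fun x => ?_
  have h1 := hφ.dist_le_mul (v x) 0
  rw [NNReal.coe_one, one_mul, dist_zero_right, dist_eq_norm] at h1
  have h2 := norm_add_le (φ (v x) - φ 0) (φ 0)
  rw [sub_add_cancel] at h2
  simp only [Pi.add_apply]
  rw [Real.norm_of_nonneg (by positivity : 0 ≤ ‖v x‖ + ‖φ 0‖)]
  linarith

theorem TendstoL1Loc.comp {v : ℕ → X → ℝ} {u : X → ℝ} {Ω : Set X} (h : TendstoL1Loc μ v u Ω)
    {φ : ℝ → ℝ} (hφ : LipschitzWith 1 φ) :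
    TendstoL1Loc μ (fun i x => φ (v i x)) (fun x => φ (u x)) Ω := by
  intro Ω' hΩ'
  refine tendsto_of_tendsto_of_tendsto_of_le_of_le tendsto_const_nhds (h Ω' hΩ')
    (fun _ => zero_le) fun i => lintegral_mono fun x => ?_
  have := hφ.edist_le_mul (v i x) (u x)
  rwa [ENNReal.coe_one, one_mul, edist_eq_enorm_sub, edist_eq_enorm_sub] at this

theorem openVariation_le_liminf {u : X → ℝ} {Ω : Set X} {v : ℕ → X → ℝ} {g : ℕ → X → ℝ≥0∞}
    (hv : ∀ i, MemN11Loc μ (v i) Ω) (hg : ∀ i, IsUpperGradientOn (g i) (v i) Ω)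
    (h : TendstoL1Loc μ v u Ω) :
    openVariation μ u Ω ≤ liminf (fun i => ∫⁻ x in Ω, g i x ∂μ) atTop :=
  iInf_le_of_le v <| iInf_le_of_le g <| iInf_le_of_le hv <| iInf_le_of_le hg <| iInf_le _ h

/-- Composing each competitor with `φ` keeps its upper gradient. -/
theorem openVariation_comp_le [IsFiniteMeasureOnCompacts μ] (u : X → ℝ) (Ω : Set X) {φ : ℝ → ℝ}
    (hφ : LipschitzWith 1 φ) :
    openVariation μ (fun x => φ (u x)) Ω ≤ openVariation μ u Ω := by
  refine le_iInf fun v => le_iInf fun g => le_iInf fun hv => le_iInf fun hg => le_iInf fun h => ?_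
  exact openVariation_le_liminf (fun i => (hv i).comp hφ) (fun i => (hg i).comp hφ) (h.comp hφ)

theorem variation_comp_le [IsFiniteMeasureOnCompacts μ] (u : X → ℝ) (A : Set X) {φ : ℝ → ℝ}
    (hφ : LipschitzWith 1 φ) :
    variation μ (fun x => φ (u x)) A ≤ variation μ u A :=
  iInf_mono fun U => iInf_mono fun _ => iInf_mono fun _ => openVariation_comp_le u U hφ

theorem variation_le_openVariation_univ (u : X → ℝ) (A : Set X) :
    variation μ u A ≤ openVariation μ u univ :=
  iInf_le_of_le univ <| iInf_le_of_le isOpen_univ <| iInf_le _ (subset_univ A)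

theorem MemN11Loc.aestronglyMeasurable [ProperSpace X] {v : X → ℝ} {Ω : Set X} (hΩ : IsOpen Ω)
    (hv : MemN11Loc μ v Ω) : AEStronglyMeasurable v (μ.restrict Ω) := by
  refine LocallyIntegrableOn.aestronglyMeasurable fun x hx => ?_
  obtain ⟨r, hr, hsub⟩ := Metric.nhds_basis_closedBall.mem_iff.1 (hΩ.mem_nhds hx)
  have hcl : closure (Metric.ball x r) ⊆ Metric.closedBall x r := Metric.closure_ball_subset_closedBall
  have hin : CompactlyInside (Metric.ball x r) Ω := ⟨Metric.isOpen_ball,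
    (isCompact_closedBall x r).of_isClosed_subset isClosed_closure hcl, hcl.trans hsub⟩
  exact ⟨Metric.ball x r, mem_nhdsWithin_of_mem_nhds (Metric.ball_mem_nhds x hr), (hv _ hin).1⟩

theorem lipschitzWith_posPart_sub_const (M : ℝ) : LipschitzWith 1 fun t : ℝ => max (t - M) 0 :=
  LipschitzWith.of_dist_le_mul fun x y => by
    simp only [Real.dist_eq, NNReal.coe_one, one_mul]
    refine (abs_max_sub_max_le_abs _ _ _).trans (le_of_eq ?_)
    congr 1
    ring

theorem lipschitzWith_posPart_const_sub (M : ℝ) : LipschitzWith 1 fun t : ℝ => max (M - t) 0 :=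
  LipschitzWith.of_dist_le_mul fun x y => by
    simp only [Real.dist_eq, NNReal.coe_one, one_mul]
    refine (abs_max_sub_max_le_abs _ _ _).trans (le_of_eq ?_)
    rw [abs_sub_comm]
    congr 1
    ring

theorem lipschitzWith_const_sub (M : ℝ) : LipschitzWith 1 fun t : ℝ => M - t :=
  LipschitzWith.of_dist_le_mul fun x y => by
    simp only [Real.dist_eq, NNReal.coe_one, one_mul]
    rw [abs_sub_comm]
    refine le_of_eq ?_
    congr 1
    ring

/-- The total variation above a level and below it add up to at most the total variation. -/
theorem openVariation_posPart_add_le [ProperSpace X] [BorelSpace X] [IsFiniteMeasureOnCompacts μ]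
    (u : X → ℝ) {Ω : Set X} (hΩ : IsOpen Ω) (M : ℝ) :
    openVariation μ (fun x => max (u x - M) 0) Ω + openVariation μ (fun x => max (M - u x) 0) Ω ≤
      openVariation μ u Ω := by
  refine le_iInf fun v => le_iInf fun g => le_iInf fun hv => le_iInf fun hg => le_iInf fun h => ?_
  choose S T hS hT hvS hvT hST using fun i =>
    exists_measurableSet_levels ((hv i).aestronglyMeasurable hΩ) M
  set c : ℕ → ℝ≥0∞ := fun i => ∫⁻ x in Ω, g i x ∂μ
  -- Each half contributes an extra `ε * g`, hence the factor `1 + 2 * ε`; it disappears as `ε → 0`.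
  have key : ∀ ε : ℝ≥0∞, ε ≠ 0 → ε ≠ ⊤ →
      openVariation μ (fun x => max (u x - M) 0) Ω + openVariation μ (fun x => max (M - u x) 0) Ω ≤
        (1 + 2 * ε) * liminf c atTop := by
    intro ε hε hεt
    have h1 := openVariation_le_liminf (μ := μ)
      (fun i => (hv i).comp (lipschitzWith_posPart_sub_const M))
      (fun i => (hg i).posPart_sub_const M (hS i) (hvS i) hε)
      (h.comp (lipschitzWith_posPart_sub_const M))
    have hg' : ∀ i, IsUpperGradientOn (fun x => (T i).indicator (g i) x + ε * g i x)
        (fun x => max (M - v i x) 0) Ω := fun i => by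
      -- The part of `v` below `M` is the part of `-v` above `-M`.
      have := ((hg i).comp (lipschitzWith_const_sub 0)).posPart_sub_const (-M) (hT i)
        (fun x hx hlt => hvT i x hx (by linarith)) hε
      simp only [zero_sub, sub_neg_eq_add, neg_add_eq_sub] at this
      exact this
    have hlip := lipschitzWith_posPart_const_sub M
    have hv' : ∀ i, MemN11Loc μ (fun x => max (M - v i x) 0) Ω := fun i => (hv i).comp hlip
    have hlim' : TendstoL1Loc μ (fun i x => max (M - v i x) 0) (fun x => max (M - u x) 0) Ω :=
      TendstoL1Loc.comp (φ := fun t => max (M - t) 0) (v := v) (u := u) h hlip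
    have h2 := openVariation_le_liminf hv' hg' hlim'
    refine (add_le_add h1 h2).trans ((liminf_add_liminf_le _ _).trans ?_)
    rw [← ENNReal.liminf_const_mul_of_ne_top (by finiteness)]
    refine liminf_le_liminf (Eventually.of_forall fun i => ?_)
    have hsplit : ∀ R : Set X, MeasurableSet R →
        ∫⁻ x in Ω, R.indicator (g i) x + ε * g i x ∂μ =
          ∫⁻ x in Ω, R.indicator (g i) x ∂μ + ε * c i := fun R hR => by
      rw [lintegral_add_left ((hg i).measurable.indicator hR),
        lintegral_const_mul ε (hg i).measurable]
    rw [hsplit _ (hS i), hsplit _ (hT i)]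
    calc _ = ∫⁻ x in Ω, (S i).indicator (g i) x ∂μ + ∫⁻ x in Ω, (T i).indicator (g i) x ∂μ
          + 2 * ε * c i := by ring
      _ ≤ c i + 2 * ε * c i := add_le_add (hST i _) le_rfl
      _ = _ := by ring
  have hlim : Tendsto (fun ε : ℝ≥0∞ => (1 + 2 * ε) * liminf c atTop) (𝓝[>] 0)
      (𝓝 ((1 + 2 * 0) * liminf c atTop)) := by
    refine ENNReal.Tendsto.mul_const (Tendsto.mono_left ?_ nhdsWithin_le_nhds) (Or.inl (by simp))
    exact tendsto_const_nhds.add (ENNReal.Tendsto.const_mul tendsto_id (Or.inr (by simp)))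
  rw [mul_zero, add_zero, one_mul] at hlim
  refine ge_of_tendsto hlim ?_
  filter_upwards [self_mem_nhdsWithin, nhdsWithin_le_nhds (gt_mem_nhds ENNReal.zero_lt_top)]
    with ε hε hεt using key ε (ne_of_gt hε) hεt.ne

theorem variation_posPart_add_le [ProperSpace X] [BorelSpace X] [IsFiniteMeasureOnCompacts μ]
    (u : X → ℝ) (A : Set X) (M : ℝ) :
    variation μ (fun x => max (u x - M) 0) A + variation μ (fun x => max (M - u x) 0) A ≤
      variation μ u A := by
  refine le_iInf fun U => le_iInf fun hU => le_iInf fun hAU => ?_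
  refine le_trans (add_le_add ?_ ?_) (openVariation_posPart_add_le u hU M)
  · exact iInf_le_of_le U <| iInf_le_of_le hU <| iInf_le _ hAU
  · exact iInf_le_of_le U <| iInf_le_of_le hU <| iInf_le _ hAU

end Variation

end LeastGradient

namespace LeastGradient

/-! ### Global approximation and vanishing via the Poincaré inequality -/

section Approximation

theorem lipschitzWith_one_sub_posPart : LipschitzWith 1 fun t : ℝ => 1 - max (1 - t) 0 := by
  simpa [Function.comp_def] using
    (lipschitzWith_const_sub 1).comp (lipschitzWith_posPart_const_sub 1)

/-- The sets `{0 < ψ < 1 / (n + 1)}` decrease to the empty set. -/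
theorem exists_measure_pos_lt_inter_le {X : Type*} [MeasurableSpace X] {μ : Measure X}
    {ψ : X → ℝ} (hψ : Measurable ψ) {B : Set X} (hB : MeasurableSet B) (hBfin : μ B ≠ ⊤)
    {κ : ℝ≥0∞} (hκ : κ ≠ 0) : ∃ s : ℝ, 0 < s ∧ μ ({x | 0 < ψ x ∧ ψ x < s} ∩ B) ≤ κ := by
  set A : ℕ → Set X := fun n => {x | 0 < ψ x ∧ ψ x < 1 / ((n : ℝ) + 1)} ∩ B
  have hA : ∀ n, MeasurableSet (A n) := fun n =>
    ((measurableSet_lt measurable_const hψ).inter (measurableSet_lt hψ measurable_const)).inter hB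
  have hanti : Antitone A := by
    intro m n hmn x hx
    exact ⟨⟨hx.1.1, hx.1.2.trans_le (one_div_le_one_div_of_le (by positivity)
      (by exact_mod_cast Nat.succ_le_succ hmn))⟩, hx.2⟩
  have hlim := tendsto_measure_iInter_atTop (μ := μ) (fun n => (hA n).nullMeasurableSet) hanti
    ⟨0, ne_top_of_le_ne_top hBfin (measure_mono inter_subset_right)⟩
  have hempty : ⋂ n, A n = ∅ := by
    refine eq_empty_of_forall_notMem fun x hx => ?_
    rw [mem_iInter] at hx
    obtain ⟨n, hn⟩ := exists_nat_one_div_lt (hx 0).1.1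
    exact lt_asymm hn (hx n).1.2
  rw [hempty, measure_empty] at hlim
  obtain ⟨n, hn⟩ := (hlim.eventually (gt_mem_nhds hκ.bot_lt)).exists
  exact ⟨1 / ((n : ℝ) + 1), by positivity, hn.le⟩

/-- A Lipschitz cutoff separating a compact set from the complement of an open set. -/
theorem exists_lipschitz_cutoff {X : Type*} [MetricSpace X] [ProperSpace X] {K U : Set X} (hK : IsCompact K)
    (hKne : K.Nonempty) (hU : IsOpen U) (hKU : K ⊆ U) :
    ∃ (L : NNReal) (ψ : X → ℝ), LipschitzWith L ψ ∧ (∀ x, 0 ≤ ψ x) ∧ (∀ x ∈ K, ψ x = 0) ∧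
      (∀ x, ψ x ≤ 1 → x ∈ U) ∧ IsCompact {x | ψ x ≤ 1} := by
  obtain ⟨δ, hδ, hδU⟩ := hK.exists_cthickening_subset_open hU hKU
  -- This cutoff is zero up to distance `δ / 2` from `K` and at most `1` exactly up to distance `δ`.
  have hlip : LipschitzWith (⟨2 / δ, by positivity⟩ : NNReal)
      fun x => max (2 / δ * Metric.infDist x K - 1) 0 := by
    refine LipschitzWith.of_dist_le_mul fun x y => ?_
    simp only [Real.dist_eq]
    refine (abs_max_sub_max_le_abs _ _ _).trans ?_
    have h1 := (Metric.lipschitz_infDist_pt K).dist_le_mul x y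
    rw [NNReal.coe_one, one_mul, Real.dist_eq] at h1
    calc |2 / δ * Metric.infDist x K - 1 - (2 / δ * Metric.infDist y K - 1)|
        = |2 / δ * (Metric.infDist x K - Metric.infDist y K)| := by congr 1; ring
      _ = 2 / δ * |Metric.infDist x K - Metric.infDist y K| := by
          rw [abs_mul, abs_of_pos (by positivity)]
      _ ≤ 2 / δ * dist x y := by gcongr
  have hsub : ∀ x, max (2 / δ * Metric.infDist x K - 1) 0 ≤ 1 → x ∈ Metric.cthickening δ K := by
    intro x hx
    have h1 := (le_max_left _ _).trans hx
    have h2 : 2 / δ * Metric.infDist x K ≤ 2 := by linarith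
    have h3 : Metric.infDist x K ≤ δ := by
      rw [div_mul_eq_mul_div, div_le_iff₀ hδ] at h2
      linarith
    rw [Metric.mem_cthickening_iff]
    exact (ENNReal.le_ofReal_iff_toReal_le (Metric.infEDist_ne_top hKne) hδ.le).2 h3
  refine ⟨_, _, hlip, fun x => le_max_right _ _, fun x hx => ?_, fun x hx => hδU (hsub x hx), ?_⟩
  · rw [Metric.infDist_zero_of_mem hx]
    simp
  · exact hK.cthickening.of_isClosed_subset (isClosed_le hlip.continuous continuous_const) hsub

variable {X : Type*} [MetricSpace X] [MeasurableSpace X] {μ : Measure X}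
  [BorelSpace X] [ProperSpace X] [IsFiniteMeasureOnCompacts μ]

/-- A function vanishing outside `Ω` and without variation on `closure Ω` can be approximated on
balls by functions on the whole space with upper gradients of small integral. -/
theorem exists_approx_of_variation_closure_eq_zero {Ω : Set X} {W : X → ℝ}
    (hW0 : ∀ x, 0 ≤ W x) (hW1 : ∀ x, W x ≤ 1) (hWΩ : ∀ᵐ x ∂μ, x ∉ Ω → W x = 0)
    (hWm : AEStronglyMeasurable W μ) (hvar : variation μ W (closure Ω) = 0)
    {x₀ : X} (hx₀ : x₀ ∈ Ω) {ρ : ℝ} (hρ : 0 < ρ) {η : ℝ≥0∞} (hη : η ≠ 0) :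
    ∃ (V : X → ℝ) (G : X → ℝ≥0∞), Integrable V μ ∧ IsUpperGradientOn G V univ ∧
      ∫⁻ x in Metric.ball x₀ ρ, ‖V x - W x‖ₑ ∂μ ≤ η ∧
      ∫⁻ x in Metric.ball x₀ ρ, G x ∂μ ≤ η := by
  set B := Metric.ball x₀ ρ
  have hBfin : μ B ≠ ⊤ := ((measure_mono Metric.ball_subset_closedBall).trans_lt
    (isCompact_closedBall x₀ ρ).measure_lt_top).ne
  have hη2 : 0 < η / 2 := ENNReal.half_pos hη
  obtain ⟨U, hU, hΩU, hUvar⟩ : ∃ U, IsOpen U ∧ closure Ω ⊆ U ∧ openVariation μ W U < η / 2 := by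
    have : variation μ W (closure Ω) < η / 2 := hvar ▸ hη2
    simpa only [variation, iInf_lt_iff, exists_prop] using this
  obtain ⟨v₀, g, hv₀, hg₀, hlim₀, hliminf⟩ : ∃ (v : ℕ → X → ℝ) (g : ℕ → X → ℝ≥0∞),
      (∀ i, MemN11Loc μ (v i) U) ∧ (∀ i, IsUpperGradientOn (g i) (v i) U) ∧
      TendstoL1Loc μ v W U ∧ liminf (fun i => ∫⁻ x in U, g i x ∂μ) atTop < η / 2 := by
    simpa only [openVariation, iInf_lt_iff, exists_prop] using hUvar
  -- Truncation `t ↦ min t 1` keeps the limit `W` and gives the bound `v ≤ 1` needed for gluing.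
  obtain ⟨v, hv, hg, hlim, hv1⟩ : ∃ v : ℕ → X → ℝ, (∀ i, MemN11Loc μ (v i) U) ∧
      (∀ i, IsUpperGradientOn (g i) (v i) U) ∧ TendstoL1Loc μ v W U ∧ ∀ i x, v i x ≤ 1 := by
    have hlip := lipschitzWith_one_sub_posPart
    have h1 := hlim₀.comp hlip
    have h2 : (fun x => 1 - max (1 - W x) 0) = W := by
      funext x
      rw [max_eq_left (by linarith [hW1 x])]
      ring
    simp only [h2] at h1
    exact ⟨_, fun i => (hv₀ i).comp hlip, fun i => (hg₀ i).comp hlip, h1,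
      fun i x => by linarith [le_max_right (1 - v₀ i x) 0]⟩
  have hK : IsCompact (closure Ω ∩ Metric.closedBall x₀ ρ) :=
    (isCompact_closedBall x₀ ρ).inter_left isClosed_closure
  obtain ⟨L, ψ, hψ, hψ0, hψK, hψU, hψc⟩ := exists_lipschitz_cutoff hK
    ⟨x₀, subset_closure hx₀, Metric.mem_closedBall_self hρ.le⟩ hU (inter_subset_left.trans hΩU)
  set O : Set X := {x | ψ x < 1}
  have hO : IsOpen O := isOpen_lt hψ.continuous continuous_const
  have hOcl : closure O ⊆ {x | ψ x ≤ 1} :=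
    closure_minimal (ofPred_subset_ofPred.2 fun _ hx => hx.le) (isClosed_le hψ.continuous continuous_const)
  have hOU : CompactlyInside O U :=
    ⟨hO, hψc.of_isClosed_subset isClosed_closure hOcl, fun x hx => hψU x (hOcl hx)⟩
  have hψB : ∀ᵐ x ∂μ, x ∈ B → 0 < ψ x → W x = 0 := by
    filter_upwards [hWΩ] with x hx hxB hpos
    refine hx fun hxΩ => hpos.ne' (hψK x ⟨subset_closure hxΩ, Metric.ball_subset_closedBall hxB⟩)
  set E : ℕ → Set X := fun i => {x | ψ x < 1 ∧ 0 < ψ x ∧ ψ x < v i x}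
  -- Split at `ψ = s`: `{0 < ψ < s}` is small by the choice of `s`, and where `ψ ≥ s` one has `v >
  -- s` or `v ≥ s` while `W = 0`, so Markov's inequality applies.
  have hE : ∀ κ : ℝ≥0∞, κ ≠ 0 → ∀ᶠ i in atTop, μ (E i ∩ B) ≤ κ := by
    intro κ hκ
    have hκ2 : 0 < κ / 2 := ENNReal.half_pos hκ
    obtain ⟨s, hs, hsκ⟩ := exists_measure_pos_lt_inter_le (μ := μ) hψ.continuous.measurable
      Metric.isOpen_ball.measurableSet hBfin hκ2.ne'
    have hs' : ENNReal.ofReal s ≠ 0 := (ENNReal.ofReal_pos.2 hs).ne'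
    have hmul : 0 < ENNReal.ofReal s * (κ / 2) := ENNReal.mul_pos hs' hκ2.ne'
    filter_upwards [(hlim O hOU).eventually (gt_mem_nhds hmul)] with i hi
    have hmeas : AEMeasurable (fun x => ‖v i x - W x‖ₑ) (μ.restrict O) :=
      ((hv i O hOU).1.aestronglyMeasurable.sub hWm.restrict).enorm
    have hmarkov := (mul_meas_ge_le_lintegral₀ hmeas (ENNReal.ofReal s)).trans hi.le
    rw [ENNReal.mul_le_mul_iff_right hs' ENNReal.ofReal_ne_top] at hmarkov
    have hsub : ∀ᵐ x ∂μ, x ∈ E i ∩ B → x ∈ {x | 0 < ψ x ∧ ψ x < s} ∩ B ∪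
        {x | ENNReal.ofReal s ≤ ‖v i x - W x‖ₑ} ∩ O := by
      filter_upwards [hψB] with x hx hxE
      obtain ⟨⟨h1, h2, h3⟩, hxB⟩ : x ∈ E i ∩ B := hxE
      have hx0 := hx hxB h2
      rcases lt_or_ge (ψ x) s with hlt | hge
      · exact Or.inl ⟨⟨h2, hlt⟩, hxB⟩
      · refine Or.inr ⟨?_, h1⟩
        change ENNReal.ofReal s ≤ ‖v i x - W x‖ₑ
        rw [hx0, sub_zero, Real.enorm_eq_ofReal (h2.trans h3).le]
        exact ENNReal.ofReal_le_ofReal (hge.trans h3.le)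
    calc μ (E i ∩ B) ≤ μ ({x | 0 < ψ x ∧ ψ x < s} ∩ B ∪
          {x | ENNReal.ofReal s ≤ ‖v i x - W x‖ₑ} ∩ O) := measure_mono_ae hsub
      _ ≤ μ ({x | 0 < ψ x ∧ ψ x < s} ∩ B) + μ ({x | ENNReal.ofReal s ≤ ‖v i x - W x‖ₑ} ∩ O) :=
          measure_union_le _ _
      _ ≤ κ / 2 + κ / 2 := add_le_add hsκ (by
          rwa [Measure.restrict_apply' hO.measurableSet] at hmarkov)
      _ = κ := ENNReal.add_halves κ
  -- This makes `L * κ ≤ η / 2`; the `+ 1` covers `L = 0`.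
  set κ : ℝ≥0∞ := η / 2 / (L + 1)
  have hκ : κ ≠ 0 := (ENNReal.div_pos hη2.ne' (by finiteness)).ne'
  obtain ⟨i, hi1, hi2, hi3⟩ := ((frequently_lt_of_liminf_lt (by isBoundedDefault) hliminf).and_eventually
    ((hE κ hκ).and ((hlim O hOU).eventually (gt_mem_nhds hη.bot_lt)))).exists
  -- `E i` need not be measurable; as its measure is finite, the hull keeps the measure of its trace
  -- on `B`.
  set E' := toMeasurable μ (E i)
  have hE' : MeasurableSet E' := measurableSet_toMeasurable _ _
  refine ⟨O.indicator fun x => max (v i x - ψ x) 0, fun x => U.indicator (g i) x +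
    E'.indicator (fun _ => (L : ℝ≥0∞)) x, ?_, ?_, ?_, ?_⟩
  · rw [integrable_indicator_iff hO.measurableSet]
    have hψint : IntegrableOn ψ O μ :=
      (hψ.continuous.continuousOn.integrableOn_compact hψc).mono_set
        (subset_closure.trans hOcl)
    exact ((hv i O hOU).1.sub hψint).pos_part
  · exact (hg i).indicator_posPart_sub hU (hv1 i) hψ hψ0 hψU hE'
      fun x h1 h2 h3 => subset_toMeasurable μ _ ⟨h1, h2, h3⟩
  · calc _ ≤ ∫⁻ x in B, O.indicator (fun x => ‖v i x - W x‖ₑ) x ∂μ := by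
          refine setLIntegral_mono_ae' Metric.isOpen_ball.measurableSet ?_
          filter_upwards [hψB] with x hx hxB
          by_cases hxO : x ∈ O
          · rw [indicator_of_mem hxO, indicator_of_mem hxO, enorm_le_iff_norm_le, Real.norm_eq_abs,
              Real.norm_eq_abs]
            rcases (hψ0 x).eq_or_lt with h0 | h0
            · rw [← h0, sub_zero]
              calc |max (v i x) 0 - W x| = |max (v i x) 0 - max (W x) 0| := by
                    rw [max_eq_left (hW0 x)]
                _ ≤ |v i x - W x| := abs_max_sub_max_le_abs _ _ _
            · rw [hx hxB h0, sub_zero, sub_zero, abs_of_nonneg (le_max_right _ _)]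
              exact max_le (by linarith [le_abs_self (v i x)]) (abs_nonneg _)
          · rw [indicator_of_notMem hxO, indicator_of_notMem hxO,
              hx hxB (zero_lt_one.trans_le (not_lt.1 hxO))]
            simp
      _ ≤ ∫⁻ x, O.indicator (fun x => ‖v i x - W x‖ₑ) x ∂μ := setLIntegral_le_lintegral _ _
      _ = ∫⁻ x in O, ‖v i x - W x‖ₑ ∂μ := lintegral_indicator hO.measurableSet _
      _ ≤ η := hi3.le
  · have hEfin : μ (E i) ≠ ⊤ :=
      ne_top_of_le_ne_top hOU.measure_lt_top.ne (measure_mono fun x hx => hx.1)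
    rw [lintegral_add_left ((hg i).measurable.indicator hU.measurableSet)]
    calc _ ≤ ∫⁻ x, U.indicator (g i) x ∂μ + L * μ (E i ∩ B) := by
          refine add_le_add (setLIntegral_le_lintegral _ _) ?_
          rw [lintegral_indicator_const hE', Measure.restrict_apply hE',
            Measure.measure_toMeasurable_inter Metric.isOpen_ball.measurableSet hEfin]
      _ ≤ η / 2 + (L + 1) * κ := by
          refine add_le_add ?_ (mul_le_mul' le_self_add hi2)
          rw [lintegral_indicator hU.measurableSet]
          exact hi1.le
      _ ≤ η / 2 + η / 2 := add_le_add le_rfl ENNReal.mul_div_le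
      _ = η := ENNReal.add_halves η

/-- In a ball meeting `Ωᶜ` in positive measure, the approximants are nearly constant by Poincaré,
and that constant is nearly zero because `W = 0` a.e. off `Ω`. -/
theorem ae_eq_zero_of_variation_closure_eq_zero (hd : IsDoubling μ) (hp : SupportsPoincare μ)
    {Ω : Set X} (hΩ : MeasurableSet Ω) (hne : Ω.Nonempty) (hpos : 0 < μ Ωᶜ) {W : X → ℝ}
    (hW0 : ∀ x, 0 ≤ W x) (hW1 : ∀ x, W x ≤ 1) (hWΩ : ∀ᵐ x ∂μ, x ∉ Ω → W x = 0)
    (hWm : AEStronglyMeasurable W μ) (hvar : variation μ W (closure Ω) = 0) :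
    ∀ᵐ x ∂μ, W x = 0 := by
  obtain ⟨x₀, hx₀⟩ := hne
  obtain ⟨c, l, hc, hl, hp⟩ := hp
  have hball : ∀ R : ℝ, 0 < R → 0 < μ (Metric.ball x₀ R ∩ Ωᶜ) →
      ∀ᵐ x ∂μ, x ∈ Metric.ball x₀ R → W x = 0 := by
    intro R hR hA
    set B := Metric.ball x₀ R
    set B' := Metric.ball x₀ (l * R)
    set A := B ∩ Ωᶜ
    have hlR : 0 < l * R := by positivity
    have hBB' : B ⊆ B' := Metric.ball_subset_ball (by nlinarith)
    have hBm : MeasurableSet B := Metric.isOpen_ball.measurableSet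
    have hAm : MeasurableSet A := hBm.inter hΩ.compl
    have hB0 : μ B ≠ 0 := (hd.measure_ball_pos x₀ hR).ne'
    have hBt : μ B ≠ ⊤ := (hd.measure_ball_lt_top x₀ R).ne
    have hB'0 : μ B' ≠ 0 := (hd.measure_ball_pos x₀ hlR).ne'
    -- The Poincaré constant once averages are replaced by integrals.
    set C : ℝ≥0∞ := ENNReal.ofReal (c * R) * (μ B')⁻¹ * μ B
    have hCt : C ≠ ⊤ := ENNReal.mul_ne_top (ENNReal.mul_ne_top ENNReal.ofReal_ne_top
      (ENNReal.inv_ne_top.2 hB'0)) hBt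
    have hAt : μ A ≠ ⊤ := ne_top_of_le_ne_top hBt (measure_mono inter_subset_left)
    have key : ∀ η : ℝ≥0∞, η ≠ 0 →
        μ A * ∫⁻ x in B, ‖W x‖ₑ ∂μ ≤ ((1 + C) * μ A + (1 + C) * μ B) * η := by
      intro η hη
      obtain ⟨V, G, hV, hG, hVW, hGη⟩ := exists_approx_of_variation_closure_eq_zero hW0 hW1 hWΩ hWm
        hvar hx₀ hlR hη
      have hVW' : ∫⁻ x in B, ‖V x - W x‖ₑ ∂μ ≤ η := (lintegral_mono_set hBB').trans hVW
      set m : ℝ := ⨍ z in B, V z ∂μ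
      have hosc : ∫⁻ x in B, ‖V x - m‖ₑ ∂μ ≤ C * η := by
        have := hp x₀ R hR V G hV.locallyIntegrable hG
        rw [setLAverage_eq, setLAverage_eq, ENNReal.div_le_iff hB0 hBt] at this
        refine this.trans ?_
        rw [ENNReal.div_eq_inv_mul]
        calc _ = C * ∫⁻ x in B', G x ∂μ := by ring
          _ ≤ C * η := mul_le_mul_right hGη _
      have hVWm : AEMeasurable (fun x => ‖V x - W x‖ₑ) μ := (hV.aestronglyMeasurable.sub hWm).enorm
      have hVmm : AEMeasurable (fun x => ‖V x - m‖ₑ) μ :=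
        (hV.aestronglyMeasurable.sub aestronglyMeasurable_const).enorm
      have hmA : ‖m‖ₑ * μ A ≤ (1 + C) * η := by
        calc ‖m‖ₑ * μ A = ∫⁻ _ in A, ‖m‖ₑ ∂μ := (setLIntegral_const _ _).symm
          _ ≤ ∫⁻ x in A, ‖V x - W x‖ₑ + ‖V x - m‖ₑ ∂μ := by
              refine setLIntegral_mono_ae' hAm ?_
              filter_upwards [hWΩ] with x hx hxA
              rw [hx hxA.2, sub_zero]
              calc ‖m‖ₑ = ‖V x - (V x - m)‖ₑ := by rw [sub_sub_cancel]
                _ ≤ _ := enorm_sub_le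
          _ ≤ ∫⁻ x in B, ‖V x - W x‖ₑ + ‖V x - m‖ₑ ∂μ := lintegral_mono_set inter_subset_left
          _ = ∫⁻ x in B, ‖V x - W x‖ₑ ∂μ + ∫⁻ x in B, ‖V x - m‖ₑ ∂μ :=
              lintegral_add_left' hVWm.restrict _
          _ ≤ η + C * η := add_le_add hVW' hosc
          _ = (1 + C) * η := by ring
      have hWB : ∫⁻ x in B, ‖W x‖ₑ ∂μ ≤ (1 + C) * η + ‖m‖ₑ * μ B := by
        calc ∫⁻ x in B, ‖W x‖ₑ ∂μ
            ≤ ∫⁻ x in B, ‖V x - W x‖ₑ + (‖V x - m‖ₑ + ‖m‖ₑ) ∂μ := by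
              refine lintegral_mono fun x => ?_
              calc ‖W x‖ₑ = ‖((V x - m) + m) - (V x - W x)‖ₑ := by congr 1; ring
                _ ≤ ‖(V x - m) + m‖ₑ + ‖V x - W x‖ₑ := enorm_sub_le
                _ ≤ (‖V x - m‖ₑ + ‖m‖ₑ) + ‖V x - W x‖ₑ := add_le_add (enorm_add_le _ _) le_rfl
                _ = _ := add_comm _ _
          _ = ∫⁻ x in B, ‖V x - W x‖ₑ ∂μ + (∫⁻ x in B, ‖V x - m‖ₑ ∂μ + ‖m‖ₑ * μ B) := by
              rw [lintegral_add_left' hVWm.restrict, lintegral_add_left' hVmm.restrict,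
                setLIntegral_const]
          _ ≤ η + (C * η + ‖m‖ₑ * μ B) := by gcongr
          _ = _ := by ring
      calc μ A * ∫⁻ x in B, ‖W x‖ₑ ∂μ ≤ μ A * ((1 + C) * η + ‖m‖ₑ * μ B) :=
            mul_le_mul_right hWB _
        _ = (1 + C) * μ A * η + (‖m‖ₑ * μ A) * μ B := by ring
        _ ≤ (1 + C) * μ A * η + ((1 + C) * η) * μ B := by gcongr
        _ = _ := by ring
    have hlim : Tendsto (fun η : ℝ≥0∞ => ((1 + C) * μ A + (1 + C) * μ B) * η) (𝓝[>] 0)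
        (𝓝 (((1 + C) * μ A + (1 + C) * μ B) * 0)) :=
      (ENNReal.Tendsto.const_mul tendsto_id (Or.inr (by finiteness))).mono_left nhdsWithin_le_nhds
    rw [mul_zero] at hlim
    have hzero : μ A * ∫⁻ x in B, ‖W x‖ₑ ∂μ ≤ 0 := by
      refine ge_of_tendsto hlim ?_
      filter_upwards [self_mem_nhdsWithin] with η hη using key η (ne_of_gt hη)
    have hint : ∫⁻ x in B, ‖W x‖ₑ ∂μ = 0 :=
      (mul_eq_zero.1 (nonpos_iff_eq_zero.1 hzero)).resolve_left hA.ne'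
    rw [lintegral_eq_zero_iff' hWm.restrict.enorm] at hint
    filter_upwards [(ae_restrict_iff' hBm).1 hint] with x hx hxB
    simpa using hx hxB
  obtain ⟨N, hN⟩ : ∃ N : ℕ, 0 < μ (Metric.ball x₀ N ∩ Ωᶜ) := by
    by_contra! hcon
    have : Ωᶜ = ⋃ n : ℕ, Metric.ball x₀ n ∩ Ωᶜ := by
      rw [← iUnion_inter, Metric.iUnion_ball_nat, univ_inter]
    rw [this, measure_iUnion_null fun n => nonpos_iff_eq_zero.1 (hcon n)] at hpos
    exact lt_irrefl _ hpos
  -- Every larger concentric ball also meets `Ωᶜ` in positive measure, and these balls exhaust `X`.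
  have hall : ∀ n : ℕ, ∀ᵐ x ∂μ, x ∈ Metric.ball x₀ ((N + n + 1 : ℕ) : ℝ) → W x = 0 := fun n =>
    hball _ (by positivity) (hN.trans_le (measure_mono (inter_subset_inter_left _
      (Metric.ball_subset_ball (by push_cast; linarith)))))
  filter_upwards [ae_all_iff.2 hall] with x hx
  obtain ⟨n, hn⟩ := exists_nat_gt (dist x x₀)
  exact hx n (by rw [Metric.mem_ball]; push_cast; linarith)

end Approximation

/-! ### Comparison with truncations of the solution -/

section MaximumPrinciple

variable {X : Type*} [MetricSpace X] [MeasurableSpace X] {μ : Measure X}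
  [IsFiniteMeasureOnCompacts μ]

theorem IsDirichletSolution.neg {Ω : Set X} {f u : X → ℝ} (hu : IsDirichletSolution μ Ω f u) :
    IsDirichletSolution μ Ω (fun x => -f x) fun x => -u x := by
  have hlip : LipschitzWith 1 fun t : ℝ => -t := by simpa using lipschitzWith_const_sub 0
  have hBV : ∀ w : X → ℝ, MemBV μ w → MemBV μ fun x => -w x := fun w hw =>
    ⟨hw.1.neg, (openVariation_comp_le w univ hlip).trans_lt hw.2⟩
  have hBV0 : ∀ w : X → ℝ, MemBV0 μ w Ω → MemBV0 μ (fun x => -w x) Ω := fun w hw =>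
    ⟨hBV w hw.1, hw.2.mono fun x hx hxΩ => by simp [hx hxΩ]⟩
  refine ⟨hBV u hu.memBV, ?_, fun g hg => ?_⟩
  · have := hBV0 _ hu.sub_memBV0
    convert this using 2
    ring
  · refine (variation_comp_le u _ hlip).trans ((hu.minimal _ (hBV0 g hg)).trans ?_)
    have heq : (fun x => u x + -g x) = fun x => -(-u x + g x) := by
      funext x
      ring
    rw [heq]
    exact variation_comp_le (fun x => -u x + g x) _ hlip

variable [BorelSpace X] [ProperSpace X]

theorem IsDirichletSolution.variation_posPart_eq_zero {Ω : Set X} {f u : X → ℝ}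
    (hu : IsDirichletSolution μ Ω f u) {M : ℝ} (hfM : ∀ᵐ x ∂μ, f x ≤ M) :
    variation μ (fun x => max (u x - M) 0) (closure Ω) = 0 := by
  have hlip : LipschitzWith 1 fun t : ℝ => -max (t - M) 0 := by
    simpa [Function.comp_def] using
      (lipschitzWith_const_sub 0).comp (lipschitzWith_posPart_sub_const M)
  have hmem : MemBV0 μ (fun x => -max (u x - M) 0) Ω := by
    refine ⟨⟨?_, (openVariation_comp_le u univ hlip).trans_lt hu.memBV.2⟩, ?_⟩
    -- `(u - M)₊ ≤ |u - f|` gives integrability even when `μ` is infinite and constants are not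
    -- integrable.
    · refine hu.sub_memBV0.1.1.mono
        (hlip.continuous.comp_aestronglyMeasurable hu.memBV.1.aestronglyMeasurable) ?_
      filter_upwards [hfM] with x hx
      rw [norm_neg, Real.norm_of_nonneg (le_max_right _ _)]
      exact max_le ((sub_le_sub_left hx _).trans (le_abs_self _)) (norm_nonneg _)
    · filter_upwards [hu.sub_memBV0.2, hfM] with x hx hxM hxΩ
      rw [max_eq_right (by linarith [hx hxΩ]), neg_zero]
  have h1 := hu.minimal _ hmem
  -- Both sides are `min u M`.
  have h2 : (fun x => u x + -max (u x - M) 0) = fun x => M - max (M - u x) 0 := by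
    funext x
    rcases le_total (u x) M with h | h
    · rw [max_eq_right (by linarith), max_eq_left (by linarith)]; ring
    · rw [max_eq_left (by linarith), max_eq_right (by linarith)]; ring
  rw [h2] at h1
  have h3 := h1.trans (variation_comp_le (fun x => max (M - u x) 0) _ (lipschitzWith_const_sub M))
  have h4 := variation_posPart_add_le (μ := μ) u (closure Ω) M
  have hfin : variation μ u (closure Ω) ≠ ⊤ :=
    ((variation_le_openVariation_univ u _).trans_lt hu.memBV.2).ne
  have h5 : variation μ (fun x => max (u x - M) 0) (closure Ω) + variation μ u (closure Ω) ≤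
      0 + variation μ u (closure Ω) := by
    rw [zero_add]
    exact (add_le_add le_rfl h3).trans h4
  exact nonpos_iff_eq_zero.1 ((ENNReal.add_le_add_iff_right hfin).1 h5)

/-- Truncating `(u - M)₊` at `1` loses nothing: `min t 1 = 0` with `t ≥ 0` forces `t = 0`. -/
theorem IsDirichletSolution.ae_le (hd : IsDoubling μ) (hp : SupportsPoincare μ) {Ω : Set X}
    (hΩ : MeasurableSet Ω) (hne : Ω.Nonempty) (hpos : 0 < μ Ωᶜ) {f u : X → ℝ}
    (hu : IsDirichletSolution μ Ω f u) {M : ℝ} (hfM : ∀ᵐ x ∂μ, f x ≤ M) :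
    ∀ᵐ x ∂μ, u x ≤ M := by
  have hlip := lipschitzWith_one_sub_posPart
  have hvar : variation μ (fun x => 1 - max (1 - max (u x - M) 0) 0) (closure Ω) = 0 :=
    nonpos_iff_eq_zero.1 ((variation_comp_le (fun x => max (u x - M) 0) _ hlip).trans
      (hu.variation_posPart_eq_zero hfM).le)
  have hzero := ae_eq_zero_of_variation_closure_eq_zero hd hp hΩ hne hpos
    (fun x => sub_nonneg.2 (max_le (by linarith [le_max_right (u x - M) 0]) zero_le_one))
    (fun x => by linarith [le_max_right (1 - max (u x - M) 0) 0])
    (by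
      filter_upwards [hu.sub_memBV0.2, hfM] with x hx hxM hxΩ
      rw [max_eq_right (by linarith [hx hxΩ] : u x - M ≤ 0)]
      simp)
    ((hlip.comp (lipschitzWith_posPart_sub_const M)).continuous.comp_aestronglyMeasurable
      hu.memBV.1.aestronglyMeasurable) hvar
  filter_upwards [hzero] with x hx
  by_contra! hlt
  rw [max_eq_left (by linarith : 0 ≤ u x - M)] at hx
  have : max (1 - (u x - M)) 0 < 1 := max_lt (by linarith) one_pos
  linarith

end MaximumPrinciple

end LeastGradient

theorem corollary5p2 {X : Type*} [MetricSpace X] [CompleteSpace X] [MeasurableSpace X]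
    [BorelSpace X] (μ : Measure X) (hdoubling : LeastGradient.IsDoubling μ)
    (hpoincare : LeastGradient.SupportsPoincare μ)
    (Ω : Set X) (hΩ_open : IsOpen Ω) (hΩ_conn : IsConnected Ω) (hΩ : 0 < μ Ωᶜ)
    (M₁ M₂ : ℝ) (f : X → ℝ) (hf : LeastGradient.MemBV μ f)
    (hfM : ∀ᵐ x ∂μ, M₁ ≤ f x ∧ f x ≤ M₂)
    (u : X → ℝ) (hu : LeastGradient.IsDirichletSolution μ Ω f u) :
    ∀ᵐ x ∂μ.restrict Ω, M₁ ≤ u x ∧ u x ≤ M₂ := by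
  have := hdoubling.properSpace
  have := hdoubling.isFiniteMeasureOnCompacts
  have h1 := hu.ae_le hdoubling hpoincare hΩ_open.measurableSet hΩ_conn.nonempty hΩ
    (hfM.mono fun _ h => h.2)
  have h2 := hu.neg.ae_le hdoubling hpoincare hΩ_open.measurableSet hΩ_conn.nonempty hΩ
    (hfM.mono fun _ h => neg_le_neg h.1)
  refine ae_restrict_of_ae ?_
  filter_upwards [h1, h2] with x hx1 hx2 using ⟨neg_le_neg_iff.1 hx2, hx1⟩
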